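/- Let $X$ be a connected CW-complex with base point $x$ and $G=\pi_1(X,x)$, let $\phi: G\to\mathbb Z^r$ be a surjective homomorphism, $K=\operatorname{Ker}\phi$, $K'=[K,K]$, and let $A(G,\phi)\otimes\mathbb C=(K/K')\otimes_{\mathbb Z}\mathbb C$ be the Alexander invariant, a module over $R=\mathbb C[\mathbb Z^r]$ on which $\mathbb Z^r=G/K$ acts by conjugation. Assume that it is a finitely generated $R$-module (as is the case when $G$ is finitely generated). For $k\ge 0$ let $V_k(G,\phi)\subseteq(\mathbb C^*)^r=\operatorname{Spec}R$ be the zero set of the $k$-th Fitting ideal of this module, i.e. of the ideal generated by the $(n-k+1)\times(n-k+1)$ minors of the matrix of $\Phi$ in a presentation $R^m\xrightarrow{\Phi}R^n\to A(G,\phi)\otimes\mathbb C\to 0$ (minors of size $\le 0$ are $1$, so that $V_k(G,\phi)=\emptyset$ for $k>n$; and $V_0(G,\phi)=(\mathbb C^*)^r$). For $P\in(\mathbb C^*)^r$ put $$f(P,(G,\phi))=\max\{k \mid P\in V_k(G,\phi)\}.$$ Let $n_1,\dots,n_r\ge 1$ and let $X_{n_1,\dots,n_r}\to X$ be the finite unbranched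 abelian cover corresponding to the kernel of $G\xrightarrow{\phi}\mathbb Z^r\to\bigoplus_{i=1}^r\mathbb Z/n_i\mathbb Z$ (a quotient of the infinite abelian cover of $X$ corresponding to $\operatorname{Ker}\phi$). Then $H_1(X,\mathbb C)$ and $H_1(X_{n_1,\dots,n_r},\mathbb C)$ are finite-dimensional, and $$\dim H_1(X_{n_1,\dots,n_r},\mathbb C)=\dim H_1(X,\mathbb C)+\sum_{\substack{\omega_i^{n_i}=1\ (1\le i\le r)\\ (\omega_1,\dots,\omega_r)\ne(1,\dots,1)}} f\bigl((\omega_1,\dots,\omega_r),(G,\phi)\bigr).$$ In particular, if $\dim H_1(X,\mathbb C)=r$ (i.e. $\phi$ is the projection of $G$ onto $H_1(X,\mathbb Z)$ modulo torsion, for example the abelianization of a link group), then $$\dim H_1(X_{n_1,\dots,n_r},\mathbb C)=r+\sum_{\substack{\omega_i^{n_i}=1\ (1\le i\le r)\\ (\omega_1,\dots,\omega_r)\ne(1,\dots,1)}} f\bigl((\omega_1,\dots,\omega_r),(G,\phi)\bigr).$$ -/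

import Mathlib

noncomputable section

open scoped TensorProduct

/-! ### Fitting ideals and characteristic varieties of modules -/

/-- The `k`-th Fitting ideal of an `R`-module `M`, generated by the
`(n - k + 1) × (n - k + 1)` minors of a presentation matrix `A` of `M`
(`R^m → R^n → M → 0`). The ideal does not depend on the presentation; here it is
generated by the minors of all finite presentations. For `k > n` the minor is the empty
determinant `1`, and the ideal is the unit ideal. -/
def fittingIdeal (R : Type*) [CommRing R] (M : Type*) [AddCommGroup M] [Module R M]
    (k : ℕ) : Ideal R :=
  Ideal.span {d : R | ∃ (m n : ℕ) (A : Matrix (Fin n) (Fin m) R)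
    (π : (Fin n → R) →ₗ[R] M),
    Function.Surjective π ∧ LinearMap.range A.mulVecLin = LinearMap.ker π ∧
    ∃ (a : Fin (n + 1 - k) → Fin n) (b : Fin (n + 1 - k) → Fin m),
      d = (A.submatrix a b).det}

/-- The free abelian group `ℤ^r`, written multiplicatively. -/
abbrev FreeAb (r : ℕ) : Type := Multiplicative (Fin r → ℤ)

/-- The group ring `ℂ[ℤ^r]`, that is, the ring of Laurent polynomials in `r` variables. -/
abbrev LaurentRing (r : ℕ) : Type := MonoidAlgebra ℂ (FreeAb r)

/-- The character `t ↦ P₁^{t₁} ⋯ P_r^{t_r}` of `ℤ^r` given by a point `P` of `(ℂ^*)^r`. -/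
def torusChar {r : ℕ} (P : Fin r → ℂˣ) : FreeAb r →* ℂ where
  toFun t := ((∏ i, P i ^ (t.toAdd i) : ℂˣ) : ℂ)
  map_one' := by simp
  map_mul' s t := by simp [zpow_add, Finset.prod_mul_distrib]

/-- Evaluation of Laurent polynomials at a point of the torus `(ℂ^*)^r`. -/
def evalTorus {r : ℕ} (P : Fin r → ℂˣ) : LaurentRing r →ₐ[ℂ] ℂ :=
  MonoidAlgebra.lift ℂ ℂ (FreeAb r) (torusChar P)

/-- The `k`-th characteristic variety of a `ℂ[ℤ^r]`-module, as a subset of `(ℂ^*)^r`. -/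
def moduleCharVariety {r : ℕ} (M : Type*) [AddCommGroup M] [Module (LaurentRing r) M]
    (k : ℕ) : Set (Fin r → ℂˣ) :=
  {P | ∀ F ∈ fittingIdeal (LaurentRing r) M k, evalTorus P F = 0}

/-! ### The Alexander invariant of a pair `(G, φ)` -/

section Alexander

variable {G : Type*} [Group G] {r : ℕ} (φ : G →* FreeAb r)

/-- The space `K/K' ⊗ ℂ`, where `K = Ker φ` and `K' = [K, K]`. -/
abbrev AlexanderSpace : Type _ := ℂ ⊗[ℤ] Additive (Abelianization φ.ker)

/-- The action of `G` on `K/K' ⊗ ℂ` induced by conjugation `k ↦ g k g⁻¹`. -/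
def conjRep : Representation ℂ G (AlexanderSpace φ) where
  toFun g := LinearMap.baseChange ℂ
    (MonoidHom.toAdditive
      (Abelianization.map (MulAut.conjNormal (H := φ.ker) g).toMonoidHom)).toIntLinearMap
  map_one' := by
    ext x
    induction x using Additive.rec with
    | ofMul x =>
      induction x using QuotientGroup.induction_on with
      | H x =>
        change (1 : ℂ) ⊗ₜ[ℤ] Additive.ofMul (Abelianization.of _) = _
        simp
        rfl
  map_mul' g h := by
    ext x
    induction x using Additive.rec with
    | ofMul x =>
      induction x using QuotientGroup.induction_on with
      | H x =>
        change (1 : ℂ) ⊗ₜ[ℤ] Additive.ofMul (Abelianization.of _) = _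
        simp
        rfl

theorem conjRep_ker (g : G) (hg : g ∈ φ.ker) : conjRep φ g = 1 := by
  ext x
  induction x using Additive.rec with
  | ofMul x =>
    induction x using QuotientGroup.induction_on with
    | H x =>
      change (1 : ℂ) ⊗ₜ[ℤ] Additive.ofMul (Abelianization.of _) =
        (1 : ℂ) ⊗ₜ[ℤ] Additive.ofMul (Abelianization.of x)
      have h : (MulAut.conjNormal (H := φ.ker) g).toMonoidHom x
          = (⟨g, hg⟩ : φ.ker) * x * (⟨g, hg⟩ : φ.ker)⁻¹ := by
        ext; simp
      rw [h]
      simp [mul_comm]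

/-- The action of `ℤ^r = G/K` on `K/K' ⊗ ℂ` for surjective `φ`: an element `t` acts as
conjugation by any `g` with `φ g = t`. -/
def alexanderRep (hφ : Function.Surjective φ) :
    Representation ℂ (FreeAb r) (AlexanderSpace φ) :=
  (QuotientGroup.lift φ.ker (conjRep φ) (fun g hg => conjRep_ker φ g hg)).comp
    (QuotientGroup.quotientKerEquivOfSurjective φ hφ).symm.toMonoidHom

/-- The Alexander invariant `A(G, φ) ⊗ ℂ` as a module over `ℂ[ℤ^r]`. -/
abbrev AlexanderModule (hφ : Function.Surjective φ) : Type _ := (alexanderRep φ hφ).asModule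

/-- The characteristic variety `V_k(G, φ) ⊆ (ℂ^*)^r`. -/
def charVariety (hφ : Function.Surjective φ) (k : ℕ) : Set (Fin r → ℂˣ) :=
  moduleCharVariety (AlexanderModule φ hφ) k

/-- The depth `f(P, (G, φ)) = max {k | P ∈ V_k(G, φ)}`. As `V_0(G, φ)` is the whole torus,
the depth of a point outside `V_1(G, φ)` is `0`. -/
def depth (hφ : Function.Surjective φ) (P : Fin r → ℂˣ) : ℕ :=
  sSup {k : ℕ | P ∈ charVariety φ hφ k}

end Alexander

/-! ### Covering spaces and first homology -/

/-- The projection `ℤ^r → ⊕ ℤ/n_i`. -/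
def reductionMod {r : ℕ} (n : Fin r → ℕ) : FreeAb r →* Multiplicative (∀ i, ZMod (n i)) :=
  AddMonoidHom.toMultiplicative
    (AddMonoidHom.pi fun i => (Int.castAddHom (ZMod (n i))).comp (Pi.evalAddMonoidHom _ i))

/-- `p : (E, e) → (X, x)` is the (path-connected) covering of `X` corresponding to the subgroup
`N` of `π₁(X, x)`: it is a covering map and `p_* π₁(E, e) = N`. -/
structure IsCoveringOf {X : Type*} [TopologicalSpace X] {E : Type*} [TopologicalSpace E]
    (p : C(E, X)) (e : E) {x : X} (hx : p e = x) (N : Subgroup (FundamentalGroup X x)) :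
    Prop where
  pathConnected : PathConnectedSpace E
  isCoveringMap : IsCoveringMap p
  range_eq : (FundamentalGroup.mapOfEq p hx).range = N

/-- The first singular homology `H_1(Y, ℂ)`. -/
abbrev H1.{u} (Y : Type u) [TopologicalSpace Y] : ModuleCat.{u} ℂ :=
  ((AlgebraicTopology.singularHomologyFunctor (ModuleCat.{u} ℂ) 1).obj
    (ModuleCat.of ℂ (ULift.{u} ℂ))).obj (TopCat.of Y)

end

/-! Write `K = Ker φ` and `N` for the kernel of `G → B = ⊕ ℤ/n_i`. A covering map is injective on
fundamental groups, so `π₁(E) ≅ N`. By a dual Hurewicz theorem (`nonempty_dual_H1_equiv_addHoms`)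
the dual of `H₁(Y, ℂ)` is `Hom(π₁ Y, ℂ)`. It remains to compare `Hom(N, ℂ)` with `Hom(G, ℂ)`.

Conjugation makes `Hom(N, ℂ)` a representation of the finite abelian group `B`, so it is the direct
sum of its eigenspaces over the characters `ψ` of `B` (`eqvDecomposition`). The eigenspace of the
trivial character is `Hom(G, ℂ)`, because `B` is finite and `ℂ` has characteristic zero
(`addHomsEquiv`). If `χ` is the character of `G` given by `ψ ≠ 0`, choose `g₀` with `χ g₀ ≠ 1`:
equivariance forces `f [g₀, x] = (χ g₀ - 1) f x`, and `[g₀, x]` lies in `K`, so restriction from `N`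
to `K` is an isomorphism of eigenspaces (`eqvEquiv`).

On `K` the eigenspace is the dual of the fibre of the Alexander module at the point `ω` of the torus
corresponding to `ψ` (`semilinearEquivEqv`). For a presentation matrix `A` with `n` generators that
fibre has dimension `n - rank A(ω)`, and the `k`-th Fitting ideal vanishes at `ω` exactly when `k`
is at most this number (`forall_fittingIdeal_eq_zero_iff`), so the dimension is the depth at `ω`.
Nontrivial characters of `B` correspond to the nontrivial tuples of roots of unity
(`charPoint_image`). -/

noncomputable section

open scoped TensorProduct

/-! ### First homology and its dual. -/

section Homology

open CategoryTheory Limits Simplicial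

section LinearAlgebra

variable {k C₂ C₁ C₀ : Type*} [Field k] [AddCommGroup C₂] [Module k C₂] [AddCommGroup C₁]
  [Module k C₁] [AddCommGroup C₀] [Module k C₀]

/-- Restriction of the functionals on `C₁` that vanish on boundaries to the dual of the homology
of `C₂ → C₁ → C₀`. -/
def dualHomologyMap (d₂ : C₂ →ₗ[k] C₁) (d₁ : C₁ →ₗ[k] C₀) (t : C₂ →ₗ[k] LinearMap.ker d₁)
    (ht : ∀ x, (t x : C₁) = d₂ x) :
    LinearMap.ker d₂.dualMap →ₗ[k] Module.Dual k (LinearMap.ker d₁ ⧸ LinearMap.range t) where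
  toFun Φ := (LinearMap.range t).liftQ (Φ.1 ∘ₗ (LinearMap.ker d₁).subtype) (by
    rintro _ ⟨x, rfl⟩
    have h : Φ.1 (d₂ x) = 0 := LinearMap.congr_fun (LinearMap.mem_ker.1 Φ.2) x
    simpa [ht] using h)
  map_add' Φ Ψ := by
    refine Submodule.linearMap_qext _ ?_
    ext; simp
  map_smul' a Φ := by
    refine Submodule.linearMap_qext _ ?_
    ext; simp

variable (d₂ : C₂ →ₗ[k] C₁) (d₁ : C₁ →ₗ[k] C₀) (t : C₂ →ₗ[k] LinearMap.ker d₁)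
  (ht : ∀ x, (t x : C₁) = d₂ x)

/-- Over a field a functional on the cycles extends to all chains, and the extension is a cocycle
because the original one kills boundaries. -/
theorem dualHomologyMap_surjective : Function.Surjective (dualHomologyMap d₂ d₁ t ht) := by
  intro ψ
  obtain ⟨Φ, hΦ⟩ := LinearMap.exists_extend (ψ ∘ₗ (LinearMap.range t).mkQ)
  refine ⟨⟨Φ, ?_⟩, ?_⟩
  · refine LinearMap.mem_ker.2 (LinearMap.ext fun x => ?_)
    have := LinearMap.congr_fun hΦ (t x)
    simp only [LinearMap.comp_apply, Submodule.subtype_apply, ht] at this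
    have h0 : (LinearMap.range t).mkQ (t x) = 0 := by simp
    rw [LinearMap.dualMap_apply, this, h0, map_zero, LinearMap.zero_apply]
  · refine Submodule.linearMap_qext _ ?_
    exact hΦ

/-- Over a field, the functionals vanishing on `ker d₁` are exactly those that factor through `d₁`.
-/
theorem mem_ker_dualHomologyMap (Φ : LinearMap.ker d₂.dualMap) :
    Φ ∈ LinearMap.ker (dualHomologyMap d₂ d₁ t ht) ↔ Φ.1 ∈ LinearMap.range d₁.dualMap := by
  rw [LinearMap.range_dualMap_eq_dualAnnihilator_ker, Submodule.mem_dualAnnihilator,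
    LinearMap.mem_ker]
  constructor
  · intro h w hw
    exact LinearMap.congr_fun h ((LinearMap.range t).mkQ ⟨w, hw⟩)
  · intro h
    refine Submodule.linearMap_qext _ (LinearMap.ext fun w => ?_)
    exact h w.1 w.2

end LinearAlgebra

/-! ### Cochains of a simplicial set. -/

namespace SSet

universe u

variable (S : SSet.{u})

/-- The `1`-cocycles of a simplicial set with complex coefficients. -/
def oneCocycles : Submodule ℂ (S _⦋1⦌ → ℂ) where
  carrier := {c | ∀ τ : S _⦋2⦌, c (S.δ 0 τ) - c (S.δ 1 τ) + c (S.δ 2 τ) = 0}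
  add_mem' {c d} hc hd τ := by simp only [Pi.add_apply]; linear_combination hc τ + hd τ
  zero_mem' τ := by simp
  smul_mem' a c hc τ := by simp only [Pi.smul_apply, smul_eq_mul]; linear_combination a * hc τ

/-- The coboundary of a `0`-cochain. -/
def coboundaryZero : (S _⦋0⦌ → ℂ) →ₗ[ℂ] (S _⦋1⦌ → ℂ) where
  toFun b σ := b (S.δ 0 σ) - b (S.δ 1 σ)
  map_add' b b' := by ext; simp; ring
  map_smul' a b := by ext; simp; ring

/-- The coefficient module of the chain complexes below. -/
abbrev complexCoeff : ModuleCat.{u} ℂ := ModuleCat.of ℂ (ULift.{u} ℂ)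

/-- The generator of the chain module attached to a simplex. -/
def chainOf {n : ℕ} (x : S _⦋n⦌) : (S.chainComplex complexCoeff.{u}).X n :=
  (S.ιChainComplex (R := complexCoeff.{u}) x).hom ⟨1⟩

/-- Functionals on the chain module are cochains. -/
def dualChainEquiv (n : ℕ) :
    Module.Dual ℂ ((S.chainComplex complexCoeff.{u}).X n) ≃ₗ[ℂ] (S _⦋n⦌ → ℂ) :=
  LinearEquiv.ofBijective
    { toFun := fun Φ x => Φ (S.chainOf x)
      map_add' := fun _ _ => rfl
      map_smul' := fun _ _ => rfl } (by
    constructor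
    · intro Φ Ψ h
      -- The functionals become morphisms to `complexCoeff`, so that extensionality for maps out of
      -- a coproduct of copies of it applies.
      have key : ModuleCat.ofHom ((ULift.moduleEquiv (R := ℂ) (M := ℂ)).symm.toLinearMap ∘ₗ Φ) =
          ModuleCat.ofHom ((ULift.moduleEquiv (R := ℂ) (M := ℂ)).symm.toLinearMap ∘ₗ Ψ) := by
        refine SSet.chainComplex_hom_ext fun x => ?_
        refine ModuleCat.hom_ext (LinearMap.ext fun a => ?_)
        have ha : a = a.down • (⟨1⟩ : ULift.{u} ℂ) := by ext; simp
        have hx : Φ (S.chainOf x) = Ψ (S.chainOf x) := congrFun h x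
        rw [ha, map_smul, map_smul]
        exact congrArg (fun z => a.down • (ULift.up z : ULift.{u} ℂ)) hx
      have := congrArg (fun f => f.hom) key
      ext v
      have := LinearMap.congr_fun this v
      simpa using this
    · intro c
      refine ⟨(ULift.moduleEquiv (R := ℂ) (M := ℂ)).toLinearMap ∘ₗ
        ((S.isColimitChainComplexXCofan complexCoeff.{u} n).desc
          (Cofan.mk complexCoeff.{u} fun x => c x • 𝟙 complexCoeff.{u})).hom, ?_⟩
      ext x
      have := (S.isColimitChainComplexXCofan complexCoeff.{u} n).fac
          (Cofan.mk complexCoeff.{u} fun x => c x • 𝟙 complexCoeff.{u}) ⟨x⟩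
      have h1 := congrArg (fun f => ULift.down (f.hom ⟨1⟩)) this
      refine h1.trans ?_
      change c x • (1 : ℂ) = c x
      simp)

theorem d_chainOf_two (τ : S _⦋2⦌) :
    ((S.chainComplex complexCoeff.{u}).d 2 1).hom (S.chainOf τ) =
      S.chainOf (S.δ 0 τ) - S.chainOf (S.δ 1 τ) + S.chainOf (S.δ 2 τ) := by
  have := congrArg (fun f => f.hom ⟨1⟩) (S.ιChainComplex_d (R := complexCoeff.{u}) τ)
  refine this.trans ?_
  rw [Fin.sum_univ_three]
  simp [chainOf, sub_eq_add_neg]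

theorem d_chainOf_one (σ : S _⦋1⦌) :
    ((S.chainComplex complexCoeff.{u}).d 1 0).hom (S.chainOf σ) =
      S.chainOf (S.δ 0 σ) - S.chainOf (S.δ 1 σ) := by
  have := congrArg (fun f => f.hom ⟨1⟩) (S.ιChainComplex_d (R := complexCoeff.{u}) σ)
  refine this.trans ?_
  rw [Fin.sum_univ_two]
  simp [chainOf, sub_eq_add_neg]

@[simp]
theorem dualChainEquiv_apply {n : ℕ} (Φ : Module.Dual ℂ ((S.chainComplex complexCoeff.{u}).X n))
    (x : S _⦋n⦌) : S.dualChainEquiv n Φ x = Φ (S.chainOf x) := rfl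

theorem mem_ker_dualMap_d_two (Φ : Module.Dual ℂ ((S.chainComplex complexCoeff.{u}).X 1)) :
    Φ ∈ LinearMap.ker ((S.chainComplex complexCoeff.{u}).d 2 1).hom.dualMap ↔
      S.dualChainEquiv 1 Φ ∈ S.oneCocycles := by
  rw [LinearMap.mem_ker, ← (S.dualChainEquiv 2).map_eq_zero_iff, funext_iff]
  refine forall_congr' fun τ => ?_
  rw [dualChainEquiv_apply, LinearMap.dualMap_apply, d_chainOf_two]
  simp

theorem mem_range_dualMap_d_one (Φ : Module.Dual ℂ ((S.chainComplex complexCoeff.{u}).X 1)) :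
    Φ ∈ LinearMap.range ((S.chainComplex complexCoeff.{u}).d 1 0).hom.dualMap ↔
      S.dualChainEquiv 1 Φ ∈ LinearMap.range S.coboundaryZero := by
  have key (Ψ) : S.dualChainEquiv 1 (((S.chainComplex complexCoeff.{u}).d 1 0).hom.dualMap Ψ) =
      S.coboundaryZero (S.dualChainEquiv 0 Ψ) := by
    ext σ
    rw [dualChainEquiv_apply, LinearMap.dualMap_apply, d_chainOf_one]
    simp [coboundaryZero]
  constructor
  · rintro ⟨Ψ, rfl⟩
    exact ⟨S.dualChainEquiv 0 Ψ, (key Ψ).symm⟩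
  · rintro ⟨b, hb⟩
    refine ⟨(S.dualChainEquiv 0).symm b, (S.dualChainEquiv 1).injective ?_⟩
    rw [key, LinearEquiv.apply_symm_apply, hb]

/-- The dual of the first homology is the quotient of cocycles by coboundaries. -/
theorem exists_oneCocycles_toDual :
    ∃ F : S.oneCocycles →ₗ[ℂ] Module.Dual ℂ
        ((S.chainComplex complexCoeff.{u}).homology 1),
      Function.Surjective F ∧
      ∀ c : S.oneCocycles, c ∈ LinearMap.ker F ↔ c.1 ∈ LinearMap.range S.coboundaryZero := by
  let K := S.chainComplex complexCoeff.{u}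
  let T := K.sc' 2 1 0
  let e : (S.chainComplex complexCoeff.{u}).homology 1 ≃ₗ[ℂ]
      (LinearMap.ker T.g.hom ⧸ LinearMap.range T.moduleCatToCycles) :=
    (ShortComplex.homologyMapIso (K.isoSc' 2 1 0 (by simp) (by simp)) ≪≫
      T.moduleCatHomologyIso).toLinearEquiv
  let D := dualHomologyMap (K.d 2 1).hom (K.d 1 0).hom T.moduleCatToCycles (fun _ => rfl)
  let j : S.oneCocycles ≃ₗ[ℂ] LinearMap.ker (K.d 2 1).hom.dualMap :=
    ((S.dualChainEquiv 1).symm.submoduleMap S.oneCocycles).trans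
      (LinearEquiv.ofEq _ _ (by
        ext Φ
        rw [mem_ker_dualMap_d_two, Submodule.mem_map_equiv, LinearEquiv.symm_symm]))
  have hj (c : S.oneCocycles) : S.dualChainEquiv 1 (j c).1 = c.1 :=
    (S.dualChainEquiv 1).apply_symm_apply _
  refine ⟨e.dualMap.toLinearMap ∘ₗ D ∘ₗ j.toLinearMap, ?_, fun c => ?_⟩
  · exact e.dualMap.surjective.comp
      ((dualHomologyMap_surjective _ _ _ fun _ => rfl).comp j.surjective)
  · have h1 := mem_ker_dualHomologyMap (K.d 2 1).hom (K.d 1 0).hom T.moduleCatToCycles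
      (fun _ => rfl) (j c)
    rw [S.mem_range_dualMap_d_one, hj] at h1
    rw [← h1]
    simp only [LinearMap.mem_ker, LinearMap.comp_apply, LinearEquiv.coe_coe]
    exact e.dualMap.map_eq_zero_iff

end SSet

/-- The space of homomorphisms from a group to the additive group of `ℂ`. -/
def addHoms (G : Type*) [Group G] : Submodule ℂ (G → ℂ) where
  carrier := {f | ∀ a b, f (a * b) = f a + f b}
  add_mem' {f g} hf hg a b := by simp only [Pi.add_apply, hf a b, hg a b]; ring
  zero_mem' := by simp
  smul_mem' t f hf a b := by simp only [Pi.smul_apply, smul_eq_mul, hf a b]; ring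

/-! ### Singular cocycles and homomorphisms from the fundamental group. -/

section Geometry

universe u

variable {Y : Type u} [TopologicalSpace Y]

/-- The singular simplicial set of a space. -/
abbrev sing (Y : Type u) [TopologicalSpace Y] : SSet.{u} := TopCat.toSSet.obj (TopCat.of Y)

/-- The singular simplex given by a continuous map. -/
def singMk {n : ℕ} (f : C(stdSimplex ℝ (Fin (n + 1)), Y)) : (sing Y) _⦋n⦌ :=
  (TopCat.toSSetObjEquiv (TopCat.of Y) (.op ⦋n⦌)).symm f

/-- The continuous map of a singular simplex. -/
def singMap {n : ℕ} (x : (sing Y) _⦋n⦌) : C(stdSimplex ℝ (Fin (n + 1)), Y) :=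
  TopCat.toSSetObjEquiv (TopCat.of Y) (.op ⦋n⦌) x

@[simp] theorem singMk_singMap {n : ℕ} (x : (sing Y) _⦋n⦌) : singMk (singMap x) = x := rfl

theorem δ_eq_singMk {n : ℕ} (i : Fin (n + 2)) (x : (sing Y) _⦋n + 1⦌) :
    (sing Y).δ i x =
      singMk ((singMap x).comp ⟨stdSimplex.map i.succAbove, stdSimplex.continuous_map _⟩) := rfl

/-- The singular `1`-simplex of a path. -/
def pathSimplex {a b : Y} (γ : Path a b) : (sing Y) _⦋1⦌ :=
  singMk (γ.toContinuousMap.comp (toContinuousMap stdSimplexHomeomorphUnitInterval))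

/-- The path from the vertex `i` to the vertex `j` of a standard simplex. -/
def edgePath {n : ℕ} (i j : Fin (n + 1)) :
    Path (stdSimplex.vertex (S := ℝ) i) (stdSimplex.vertex j) where
  toFun t := stdSimplex.map ![i, j] (stdSimplexHomeomorphUnitInterval.symm t)
  continuous_toFun := (stdSimplex.continuous_map _).comp (Homeomorph.continuous _)
  source' := by
    rw [← stdSimplexHomeomorphUnitInterval_zero, Homeomorph.symm_apply_apply]
    exact stdSimplex.map_vertex _ _
  target' := by
    rw [← stdSimplexHomeomorphUnitInterval_one, Homeomorph.symm_apply_apply]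
    exact stdSimplex.map_vertex _ _

theorem δ_eq_pathSimplex (i : Fin 3) (j k : Fin 3) (h : (i.succAbove : Fin 2 → Fin 3) = ![j, k])
    (τ : (sing Y) _⦋2⦌) :
    (sing Y).δ i τ = pathSimplex ((edgePath j k).map (singMap τ).continuous) := by
  rw [δ_eq_singMk, pathSimplex]
  congr 1
  ext z
  simp [edgePath, h]

theorem pathSimplex_edgePath (σ : (sing Y) _⦋1⦌) :
    pathSimplex ((edgePath 0 1).map (singMap σ).continuous) = σ := by
  rw [pathSimplex, ← singMk_singMap σ]
  congr 1
  ext z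
  have : (![0, 1] : Fin 2 → Fin 2) = id := by ext i; fin_cases i <;> rfl
  change singMap σ (stdSimplex.map ![0, 1] (stdSimplexHomeomorphUnitInterval.symm
    (stdSimplexHomeomorphUnitInterval z))) = _
  simp [this]

theorem edgePath_trans_homotopic {n : ℕ} (i j k : Fin (n + 1)) :
    ((edgePath i j).trans (edgePath j k)).Homotopic (edgePath i k) := by
  have : ContractibleSpace (stdSimplex ℝ (Fin (n + 1))) :=
    (convex_stdSimplex ℝ _).contractibleSpace ⟨_, (stdSimplex.vertex 0).2⟩
  exact SimplyConnectedSpace.paths_homotopic _ _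

theorem δ_singMk_eq_pathSimplex {a b : Y} (F : C(stdSimplex ℝ (Fin 3), Y)) (i : Fin 3)
    (j k : Fin 3) (h : (i.succAbove : Fin 2 → Fin 3) = ![j, k])
    (γ : Path a b) (hγ : ∀ t, γ t = F (edgePath j k t)) :
    (sing Y).δ i (singMk F) = pathSimplex γ := by
  rw [δ_eq_pathSimplex i j k h, pathSimplex, pathSimplex]
  congr 1
  ext z
  simp only [ContinuousMap.comp_apply, Path.coe_toContinuousMap, hγ]
  rfl

theorem edgePath_apply (j k l : Fin 3) (t : unitInterval) :
    (edgePath j k t : stdSimplex ℝ (Fin 3)) l =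
      (if j = l then 1 - (t : ℝ) else 0) + (if k = l then (t : ℝ) else 0) := by
  change FunOnFinite.linearMap ℝ ℝ ![j, k] ![1 - (t : ℝ), t] l = _
  simp [FunOnFinite.linearMap_apply_apply, Finset.sum_filter, Fin.sum_univ_two]
  congr

/-- The coordinate `α z₁ + z₂` of the triangle, as a map to the unit interval. -/
def triangleCoord (α : ℝ) (hα : 0 ≤ α) (hα' : α ≤ 1) : C(stdSimplex ℝ (Fin 3), unitInterval) where
  toFun z := ⟨α * z 1 + z 2, by
    have h := stdSimplex.sum_eq_one z
    rw [Fin.sum_univ_three] at h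
    have h0 := stdSimplex.zero_le z 0
    have h1 := stdSimplex.zero_le z 1
    have h2 := stdSimplex.zero_le z 2
    constructor <;> nlinarith⟩
  continuous_toFun := by
    refine Continuous.subtype_mk ?_ _
    have (i : Fin 3) : Continuous fun z : stdSimplex ℝ (Fin 3) => z i :=
      (continuous_apply i).comp continuous_subtype_val
    exact (continuous_const.mul (this 1)).add (this 2)

theorem coe_triangleCoord_edgePath (α : ℝ) (hα : 0 ≤ α) (hα' : α ≤ 1) (j k : Fin 3)
    (t : unitInterval) :
    (triangleCoord α hα hα' (edgePath j k t) : ℝ) =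
      α * ((if j = 1 then 1 - (t : ℝ) else 0) + (if k = 1 then (t : ℝ) else 0)) +
      ((if j = 2 then 1 - (t : ℝ) else 0) + (if k = 2 then (t : ℝ) else 0)) := by
  rw [← edgePath_apply, ← edgePath_apply]
  rfl

section Cocycle

variable {c : (sing Y) _⦋1⦌ → ℂ}

/-- The paths are compared with the edges of `F` pointwise and their end points are left free, so no
casts between path types are needed. -/
theorem cocycle_triangle (hc : c ∈ (sing Y).oneCocycles)
    {a₁ b₁ a₂ b₂ a₃ b₃ : Y} (F : C(stdSimplex ℝ (Fin 3), Y))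
    (γ₀₁ : Path a₁ b₁) (γ₁₂ : Path a₂ b₂) (γ₀₂ : Path a₃ b₃)
    (h₀₁ : ∀ t, γ₀₁ t = F (edgePath 0 1 t)) (h₁₂ : ∀ t, γ₁₂ t = F (edgePath 1 2 t))
    (h₀₂ : ∀ t, γ₀₂ t = F (edgePath 0 2 t)) :
    c (pathSimplex γ₀₂) = c (pathSimplex γ₀₁) + c (pathSimplex γ₁₂) := by
  have h := hc (singMk F)
  rw [δ_singMk_eq_pathSimplex F 0 1 2 (by decide) γ₁₂ h₁₂,
    δ_singMk_eq_pathSimplex F 1 0 2 (by decide) γ₀₂ h₀₂,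
    δ_singMk_eq_pathSimplex F 2 0 1 (by decide) γ₀₁ h₀₁] at h
  linear_combination -h

theorem cocycle_refl (hc : c ∈ (sing Y).oneCocycles) (a : Y) :
    c (pathSimplex (Path.refl a)) = 0 := by
  have := cocycle_triangle hc (ContinuousMap.const _ a) (Path.refl a) (Path.refl a) (Path.refl a)
    (fun _ => rfl) (fun _ => rfl) (fun _ => rfl)
  simpa using this

theorem trans_apply_of_eq_half {a b d : Y} (γ : Path a b) (δ : Path b d) {s t : unitInterval}
    (h : (s : ℝ) = 1 / 2 * t) : γ.trans δ s = γ t := by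
  have ht := t.2.2
  rw [Path.trans_apply, dif_pos (by rw [h]; linarith)]
  congr 1
  ext
  change 2 * (s : ℝ) = t
  linarith

theorem trans_apply_of_eq_half_add_half {a b d : Y} (γ : Path a b) (δ : Path b d)
    {s t : unitInterval} (h : (s : ℝ) = 1 / 2 * (1 - t) + t) : γ.trans δ s = δ t := by
  rw [← Path.symm_symm γ, ← Path.symm_symm δ, ← Path.trans_symm, Path.symm_apply,
    Path.symm_apply]
  apply trans_apply_of_eq_half
  rw [unitInterval.coe_symm_eq, unitInterval.coe_symm_eq]
  linarith

/-- The triangle is projected affinely to `[0, 1]` with vertices going to `0`, `1/2`, `1`, then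
mapped by the concatenated path. -/
theorem cocycle_trans (hc : c ∈ (sing Y).oneCocycles) {a b d : Y}
    (γ : Path a b) (δ : Path b d) :
    c (pathSimplex (γ.trans δ)) = c (pathSimplex γ) + c (pathSimplex δ) := by
  have h (j k t) := coe_triangleCoord_edgePath (1 / 2) (by norm_num) (by norm_num) j k t
  refine cocycle_triangle hc ((γ.trans δ).toContinuousMap.comp
    (triangleCoord (1 / 2) (by norm_num) (by norm_num))) _ _ _ ?_ ?_ ?_
  · exact fun t => (trans_apply_of_eq_half _ _ ((h 0 1 t).trans (by simp))).symm
  · exact fun t => (trans_apply_of_eq_half_add_half _ _ ((h 1 2 t).trans (by simp))).symm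
  · exact fun t => congrArg _ (Subtype.ext ((h 0 2 t).trans (by simp))).symm

/-- The square of the homotopy is cut along its diagonal. Each half has one of the two paths, the
diagonal and a constant path as edges, since the homotopy fixes end points. -/
theorem cocycle_homotopic (hc : c ∈ (sing Y).oneCocycles) {a b : Y} {γ δ : Path a b}
    (h : γ.Homotopic δ) :
    c (pathSimplex γ) = c (pathSimplex δ) := by
  obtain ⟨F⟩ := h
  let diag : Path a b :=
    { toFun := fun t => F (t, t)
      continuous_toFun := by fun_prop
      source' := by simp
      target' := by simp }
  let u := triangleCoord 1 (by norm_num) (by norm_num)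
  let v := triangleCoord 0 (by norm_num) (by norm_num)
  have hu (j k t) := coe_triangleCoord_edgePath 1 (by norm_num) (by norm_num) j k t
  have hv (j k t) := coe_triangleCoord_edgePath 0 (by norm_num) (by norm_num) j k t
  have hu01 (t) : u (edgePath 0 1 t) = t := Subtype.ext ((hu 0 1 t).trans (by simp))
  have hu12 (t) : u (edgePath 1 2 t) = 1 := Subtype.ext ((hu 1 2 t).trans (by simp))
  have hu02 (t) : u (edgePath 0 2 t) = t := Subtype.ext ((hu 0 2 t).trans (by simp))
  have hv01 (t) : v (edgePath 0 1 t) = 0 := Subtype.ext ((hv 0 1 t).trans (by simp))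
  have hv12 (t) : v (edgePath 1 2 t) = t := Subtype.ext ((hv 1 2 t).trans (by simp))
  have hv02 (t) : v (edgePath 0 2 t) = t := Subtype.ext ((hv 0 2 t).trans (by simp))
  have h1 := cocycle_triangle hc (F.toContinuousMap.comp (u.prodMk v)) (Path.refl a) δ diag
    (fun t => by
      change a = F (u _, v _)
      rw [hu01, hv01, F.source])
    (fun t => by
      change δ t = F (u _, v _)
      rw [hu12, hv12, F.apply_one]; rfl)
    (fun t => by
      change F (t, t) = F (u _, v _)
      rw [hu02, hv02])
  have h2 := cocycle_triangle hc (F.toContinuousMap.comp (v.prodMk u)) γ (Path.refl b) diag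
    (fun t => by
      change γ t = F (v _, u _)
      rw [hu01, hv01, F.apply_zero]; rfl)
    (fun t => by
      change b = F (v _, u _)
      rw [hu12, hv12, F.target])
    (fun t => by
      change F (t, t) = F (v _, u _)
      rw [hu02, hv02])
  rw [cocycle_refl hc] at h1 h2
  linear_combination h1 - h2

theorem cocycle_symm (hc : c ∈ (sing Y).oneCocycles) {a b : Y} (γ : Path a b) :
    c (pathSimplex γ.symm) = -c (pathSimplex γ) := by
  have h : (γ.trans γ.symm).Homotopic (Path.refl a) := ⟨(Path.Homotopy.reflTransSymm γ).symm⟩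
  have := cocycle_homotopic hc h
  rw [cocycle_trans hc, cocycle_refl hc] at this
  linear_combination this

end Cocycle

/-- Evaluation of `1`-cocycles on loops. -/
def loopEval (y : Y) : (sing Y).oneCocycles →ₗ[ℂ] addHoms (FundamentalGroup Y y) where
  toFun c := ⟨fun g => Quotient.lift (fun γ : Path y y => c.1 (pathSimplex γ))
      (fun _ _ h => cocycle_homotopic c.2 h) (FundamentalGroup.toPath g), by
    intro g h
    induction g using Path.Homotopic.Quotient.ind with | mk γ => ?_
    induction h using Path.Homotopic.Quotient.ind with | mk δ => ?_
    -- The product of the classes of `γ` and `δ` is the class of `δ` followed by `γ`.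
    exact (cocycle_trans c.2 δ γ).trans (add_comm _ _)⟩
  map_add' c d := by
    ext g
    induction g using Path.Homotopic.Quotient.ind with | mk γ => ?_
    rfl
  map_smul' a c := by
    ext g
    induction g using Path.Homotopic.Quotient.ind with | mk γ => ?_
    rfl

theorem loopEval_mk {y : Y} (c : (sing Y).oneCocycles) (γ : Path y y) :
    (loopEval y c).1 (FundamentalGroup.fromPath (.mk γ)) = c.1 (pathSimplex γ) := rfl

theorem δ_pathSimplex_zero {a b : Y} (γ : Path a b) :
    (sing Y).δ 0 (pathSimplex γ) = singMk (ContinuousMap.const _ b) := by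
  rw [δ_eq_singMk]
  congr 1
  ext z
  obtain rfl : z = stdSimplex.vertex 0 := Subsingleton.elim _ _
  change γ (stdSimplexHomeomorphUnitInterval (stdSimplex.map _ (stdSimplex.vertex 0))) = b
  rw [stdSimplex.map_vertex]
  exact γ.target

theorem δ_pathSimplex_one {a b : Y} (γ : Path a b) :
    (sing Y).δ 1 (pathSimplex γ) = singMk (ContinuousMap.const _ a) := by
  rw [δ_eq_singMk]
  congr 1
  ext z
  obtain rfl : z = stdSimplex.vertex 0 := Subsingleton.elim _ _
  change γ (stdSimplexHomeomorphUnitInterval (stdSimplex.map _ (stdSimplex.vertex 0))) = a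
  rw [stdSimplex.map_vertex]
  exact γ.source

/-- If `c` vanishes on loops, its value on a chosen path from `y` to `a` is a potential `b a`, and
`c` is the coboundary of `b`. Conversely the two faces of a loop coincide. -/
theorem mem_ker_loopEval [PathConnectedSpace Y] (y : Y) (c : (sing Y).oneCocycles) :
    c ∈ LinearMap.ker (loopEval y) ↔ c.1 ∈ LinearMap.range (sing Y).coboundaryZero := by
  constructor
  · intro h
    let b : Y → ℂ := fun a => c.1 (pathSimplex (PathConnectedSpace.somePath y a))
    refine ⟨fun v => b (singMap v (stdSimplex.vertex 0)), funext fun σ => ?_⟩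
    obtain ⟨a, d, γ, rfl⟩ : ∃ (a d : Y) (γ : Path a d), σ = pathSimplex γ :=
      ⟨_, _, _, (pathSimplex_edgePath σ).symm⟩
    have h1 := loopEval_mk c (((PathConnectedSpace.somePath y a).trans γ).trans
      (PathConnectedSpace.somePath y d).symm)
    rw [LinearMap.mem_ker.1 h, cocycle_trans c.2, cocycle_trans c.2, cocycle_symm c.2] at h1
    change b (singMap _ _) - b (singMap _ _) = _
    rw [δ_pathSimplex_zero, δ_pathSimplex_one]
    change b d - b a = _
    have h2 : (0 : ℂ) = b a + c.1 (pathSimplex γ) + -b d := h1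
    linear_combination h2
  · rintro ⟨b, hb⟩
    refine LinearMap.mem_ker.2 (Subtype.ext (funext fun g => ?_))
    induction g using Path.Homotopic.Quotient.ind with | mk γ => ?_
    refine (loopEval_mk c γ).trans ?_
    rw [← hb]
    change b _ - b _ = 0
    rw [δ_pathSimplex_zero, δ_pathSimplex_one, sub_self]

/-- The class in the fundamental group of the loop obtained from a path by joining its end points
to the base point. -/
def basedLoop [PathConnectedSpace Y] (y : Y) {a b : Y} (γ : Path a b) : FundamentalGroup Y y :=
  FundamentalGroup.fromPath
    (((Path.Homotopic.Quotient.mk (PathConnectedSpace.somePath y a)).trans (.mk γ)).trans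
      (Path.Homotopic.Quotient.mk (PathConnectedSpace.somePath y b)).symm)

theorem basedLoop_congr [PathConnectedSpace Y] (y : Y) {a b a' b' : Y} (γ : Path a b)
    (γ' : Path a' b') (h : ∀ t, γ t = γ' t) : basedLoop y γ = basedLoop y γ' := by
  obtain rfl : a = a' := by simpa using h 0
  obtain rfl : b = b' := by simpa using h 1
  obtain rfl : γ = γ' := Path.ext (funext h)
  rfl

theorem basedLoop_trans [PathConnectedSpace Y] (y : Y) {a b d : Y} (γ : Path a b) (δ : Path b d) :
    basedLoop y (γ.trans δ) = basedLoop y δ * basedLoop y γ := by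
  let p (a : Y) : FundamentalGroupoid.mk y ⟶ FundamentalGroupoid.mk a :=
    Path.Homotopic.Quotient.mk (PathConnectedSpace.somePath y a)
  let m {a b : Y} (γ : Path a b) : FundamentalGroupoid.mk a ⟶ FundamentalGroupoid.mk b :=
    Path.Homotopic.Quotient.mk γ
  change (p a ≫ (m γ ≫ m δ)) ≫ Groupoid.inv (p d) =
    ((p a ≫ m γ) ≫ Groupoid.inv (p b)) ≫ ((p b ≫ m δ) ≫ Groupoid.inv (p d))
  simp

/-- The chosen path from `y` to itself need not be trivial, hence the conjugation. -/
theorem basedLoop_loop [PathConnectedSpace Y] (y : Y) (γ : Path y y) :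
    ∃ g : FundamentalGroup Y y,
      basedLoop y γ = g⁻¹ * FundamentalGroup.fromPath (.mk γ) * g :=
  ⟨FundamentalGroup.fromPath (.mk (PathConnectedSpace.somePath y y)), by
    rw [mul_assoc]; rfl⟩

/-- A homomorphism `f` is evaluated on each edge after closing the edge up to a based loop. The
cocycle condition holds because a triangle is contractible. On loops at `y` the closing up is a
conjugation, which `f` does not see. -/
theorem loopEval_surjective [PathConnectedSpace Y] (y : Y) :
    Function.Surjective (loopEval y) := by
  intro f
  let c : (sing Y) _⦋1⦌ → ℂ := fun σ =>
    f.1 (basedLoop y ((edgePath 0 1).map (singMap σ).continuous))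
  have hcγ {a b : Y} (γ : Path a b) : c (pathSimplex γ) = f.1 (basedLoop y γ) := by
    refine congrArg f.1 (basedLoop_congr y _ _ fun t => ?_)
    have : (![0, 1] : Fin 2 → Fin 2) = id := by ext i; fin_cases i <;> rfl
    change γ (stdSimplexHomeomorphUnitInterval
      (stdSimplex.map ![0, 1] (stdSimplexHomeomorphUnitInterval.symm t))) = γ t
    simp [this]
  have hc : c ∈ (sing Y).oneCocycles := by
    intro τ
    rw [δ_eq_pathSimplex 0 1 2 (by decide), δ_eq_pathSimplex 1 0 2 (by decide),
      δ_eq_pathSimplex 2 0 1 (by decide), hcγ, hcγ, hcγ]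
    have h1 : basedLoop y ((edgePath 0 2).map (singMap τ).continuous) =
        basedLoop y (((edgePath 0 1).trans (edgePath 1 2)).map (singMap τ).continuous) := by
      have := (edgePath_trans_homotopic (0 : Fin 3) 1 2).map (singMap τ)
      unfold basedLoop
      rw [Path.Homotopic.Quotient.eq.2 this]
    rw [h1, Path.map_trans, basedLoop_trans, f.2]
    ring
  refine ⟨⟨c, hc⟩, Subtype.ext (funext fun g => ?_)⟩
  induction g using Path.Homotopic.Quotient.ind with | mk γ => ?_
  refine (loopEval_mk _ γ).trans ((hcγ γ).trans ?_)
  obtain ⟨g, hg⟩ := basedLoop_loop y γ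
  have h1 := f.2 g g⁻¹
  have h2 := f.2 1 1
  rw [mul_inv_cancel] at h1
  rw [mul_one] at h2
  rw [hg, f.2, f.2]
  change f.1 g⁻¹ + f.1 (FundamentalGroup.fromPath (.mk γ)) + f.1 g =
    f.1 (FundamentalGroup.fromPath (.mk γ))
  linear_combination -h1 - h2

/-- The dual form of the Hurewicz theorem in degree one: the dual of `H₁(Y, ℂ)` is the space of
homomorphisms from the fundamental group to `ℂ`. -/
theorem nonempty_dual_H1_equiv_addHoms [PathConnectedSpace Y] (y : Y) :
    Nonempty (Module.Dual ℂ (H1 Y) ≃ₗ[ℂ] addHoms (FundamentalGroup Y y)) := by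
  obtain ⟨F, hF, hker⟩ := (sing Y).exists_oneCocycles_toDual
  have h : LinearMap.ker F = LinearMap.ker (loopEval y) := by
    ext c
    rw [hker, mem_ker_loopEval]
  exact ⟨(F.quotKerEquivOfSurjective hF).symm.trans ((Submodule.quotEquivOfEq _ _ h).trans
    ((loopEval y).quotKerEquivOfSurjective (loopEval_surjective y)))⟩

end Geometry

end Homology

/-! ### Rank and minors. -/

section Minors

variable {k : Type*} [Field k]

theorem exists_linearIndependent_rows {n m s : ℕ} (B : Matrix (Fin n) (Fin m) k)
    (hs : s ≤ B.rank) : ∃ a : Fin s → Fin n, LinearIndependent k (fun i => B (a i)) := by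
  obtain ⟨κ, a, ha, hsp, hli⟩ := exists_linearIndependent' k B.row
  have : Fintype κ := Fintype.ofInjective a ha
  have hcard : Fintype.card κ = B.rank := by
    rw [Matrix.rank_eq_finrank_span_row, ← hsp, finrank_span_eq_card hli]
  obtain ⟨e⟩ : Nonempty (Fin s ↪ κ) := Function.Embedding.nonempty_of_card_le (by simpa [hcard])
  exact ⟨a ∘ e, hli.comp e e.injective⟩

/-- A nonzero minor of size `s ≤ rank` arises by picking `s` independent rows and then `s`
independent columns of those rows. For `s = 0` both sides are false, the empty determinant being
`1`. -/
theorem forall_minors_eq_zero_iff {n m : ℕ} (s : ℕ) (B : Matrix (Fin n) (Fin m) k) :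
    (∀ (a : Fin s → Fin n) (b : Fin s → Fin m), (B.submatrix a b).det = 0) ↔ B.rank < s := by
  constructor
  · intro h
    by_contra! hs
    obtain ⟨a, ha⟩ := exists_linearIndependent_rows B hs
    have h1 : (B.submatrix a id).rank = s := by
      have := LinearIndependent.rank_matrix (M := B.submatrix a id) ha
      simpa using this
    have h2 : s ≤ (B.submatrix a id).transpose.rank := by rw [Matrix.rank_transpose, h1]
    obtain ⟨b, hb⟩ := exists_linearIndependent_rows _ h2
    have h3 : IsUnit (B.submatrix a b).transpose := by
      rw [← Matrix.linearIndependent_rows_iff_isUnit]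
      exact hb
    have h4 := (Matrix.isUnit_iff_isUnit_det _).1 h3
    rw [Matrix.det_transpose, h a b] at h4
    exact not_isUnit_zero h4
  · intro h a b
    by_contra hd
    have := Matrix.rank_of_det_ne_zero hd
    have h2 := B.rank_submatrix_le a b
    rw [this, Fintype.card_fin] at h2
    omega

end Minors

/-! ### Fitting ideals and fibres of a module. -/

section Fitting

variable {R k M : Type*} [CommRing R] [Field k] (σ : R →+* k) [AddCommGroup M] [Module R M]
  {n m : ℕ} (A : Matrix (Fin n) (Fin m) R) (π : (Fin n → R) →ₗ[R] M)

/-- The `σ`-semilinear form on `R^n` with given values on the standard basis. -/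
def semilinearForm (v : Fin n → k) : (Fin n → R) →ₛₗ[σ] k where
  toFun x := ∑ i, σ (x i) * v i
  map_add' x y := by simp [add_mul, Finset.sum_add_distrib]
  map_smul' a x := by simp [Finset.mul_sum, mul_assoc]

theorem semilinearForm_apply_single (v : Fin n → k) (i : Fin n) :
    semilinearForm σ v (Pi.single i 1) = v i := by
  simp [semilinearForm, Pi.single_apply, apply_ite σ]

theorem semilinear_ext {f g : (Fin n → R) →ₛₗ[σ] k}
    (h : ∀ i, f (Pi.single i 1) = g (Pi.single i 1)) : f = g := by
  ext x
  have hx : x = ∑ i, x i • (Pi.single i 1 : Fin n → R) := by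
    ext j; simp [Finset.sum_apply, Pi.single_apply]
  rw [hx, map_sum, map_sum]
  simp [h]

theorem semilinearForm_mulVec (v : Fin n → k) (w : Fin m → R) :
    semilinearForm σ v (A.mulVec w) =
      ∑ j, σ (w j) * ((A.map σ).transpose.mulVec v) j := by
  simp only [semilinearForm, LinearMap.coe_mk, AddHom.coe_mk, Matrix.mulVec, dotProduct, map_sum,
    map_mul, Matrix.transpose_apply, Matrix.map_apply, Finset.mul_sum, Finset.sum_mul]
  rw [Finset.sum_comm]
  exact Finset.sum_congr rfl fun _ _ => Finset.sum_congr rfl fun _ _ => by ring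

/-- Values on the generators of a semilinear form on a presented module. -/
def semilinearEvalGen : (M →ₛₗ[σ] k) →ₗ[k] (Fin n → k) where
  toFun f i := f (π (Pi.single i 1))
  map_add' _ _ := rfl
  map_smul' _ _ := rfl

variable {A π}

theorem semilinearEvalGen_injective (hπ : Function.Surjective π) :
    Function.Injective (semilinearEvalGen σ π) := by
  intro f g h
  have : f.comp π = g.comp π := semilinear_ext σ fun i => congrFun h i
  ext x
  obtain ⟨y, rfl⟩ := hπ x
  exact LinearMap.congr_fun this y

/-- A form on `M` amounts to values on the generators that respect the relations, which are the
columns of `A`. -/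
theorem range_semilinearEvalGen (hπ : Function.Surjective π)
    (hA : LinearMap.range A.mulVecLin = LinearMap.ker π) :
    LinearMap.range (semilinearEvalGen σ π) =
      LinearMap.ker (A.map σ).transpose.mulVecLin := by
  ext v
  rw [LinearMap.mem_ker, Matrix.mulVecLin_apply]
  constructor
  · rintro ⟨f, rfl⟩
    have hf : f.comp π = semilinearForm σ (semilinearEvalGen σ π f) :=
      semilinear_ext σ fun i => by rw [semilinearForm_apply_single]; rfl
    ext j
    have h1 := semilinearForm_mulVec σ A (semilinearEvalGen σ π f) (Pi.single j 1)
    have h2 : π (A.mulVec (Pi.single j 1)) = 0 := by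
      rw [← LinearMap.mem_ker, ← hA]
      exact ⟨_, rfl⟩
    rw [← hf, LinearMap.comp_apply, h2, map_zero] at h1
    simpa [Pi.single_apply, apply_ite σ] using h1.symm
  · intro hv
    have hker : LinearMap.ker π ≤ LinearMap.ker (semilinearForm σ v) := by
      rw [← hA]
      rintro _ ⟨w, rfl⟩
      rw [LinearMap.mem_ker, Matrix.mulVecLin_apply, semilinearForm_mulVec, hv]
      simp
    refine ⟨((LinearMap.ker π).liftQ (semilinearForm σ v) hker).comp
      (π.quotKerEquivOfSurjective hπ).symm.toLinearMap, ?_⟩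
    ext i
    have : (π.quotKerEquivOfSurjective hπ).symm (π (Pi.single i 1)) =
        (LinearMap.ker π).mkQ (Pi.single i 1) := by
      rw [LinearEquiv.symm_apply_eq]; rfl
    change (LinearMap.ker π).liftQ (semilinearForm σ v) hker
      ((π.quotKerEquivOfSurjective hπ).symm (π (Pi.single i 1))) = _
    rw [this]
    exact semilinearForm_apply_single σ v i

theorem finite_semilinear (hπ : Function.Surjective π) : Module.Finite k (M →ₛₗ[σ] k) :=
  Module.Finite.of_injective _ (semilinearEvalGen_injective σ hπ)

/-- Rank-nullity for the specialised transposed matrix. The `σ`-semilinear forms play the role of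
the dual of the fibre `M ⊗ k`. -/
theorem finrank_semilinear_add_rank (hπ : Function.Surjective π)
    (hA : LinearMap.range A.mulVecLin = LinearMap.ker π) :
    Module.finrank k (M →ₛₗ[σ] k) + (A.map σ).rank = n := by
  have h1 := LinearMap.finrank_range_of_inj (semilinearEvalGen_injective σ hπ)
  have h2 := (A.map σ).transpose.mulVecLin.finrank_range_add_finrank_ker
  rw [← range_semilinearEvalGen σ hπ hA, h1] at h2
  rw [← Matrix.rank_transpose, Matrix.rank, add_comm, h2]
  simp

variable (M)

theorem exists_presentation [IsNoetherianRing R] [Module.Finite R M] :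
    ∃ (m n : ℕ) (A : Matrix (Fin n) (Fin m) R) (π : (Fin n → R) →ₗ[R] M),
      Function.Surjective π ∧ LinearMap.range A.mulVecLin = LinearMap.ker π := by
  obtain ⟨n, π, hπ⟩ := Module.Finite.exists_fin' R M
  obtain ⟨m, q, hq⟩ := Module.Finite.exists_fin' R (LinearMap.ker π)
  refine ⟨m, n, LinearMap.toMatrix' ((LinearMap.ker π).subtype ∘ₗ q), π, hπ, ?_⟩
  rw [← Matrix.toLin'_apply', Matrix.toLin'_toMatrix', LinearMap.range_comp,
    LinearMap.range_eq_top.2 hq, Submodule.map_top, Submodule.range_subtype]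

/-- A point lies in the zero set of the `j`-th Fitting ideal iff the fibre of the module at the
point has dimension at least `j`. -/
theorem forall_fittingIdeal_eq_zero_iff [IsNoetherianRing R] [Module.Finite R M] (j : ℕ) :
    (∀ F ∈ fittingIdeal R M j, σ F = 0) ↔ j ≤ Module.finrank k (M →ₛₗ[σ] k) := by
  have hspan : (∀ F ∈ fittingIdeal R M j, σ F = 0) ↔ fittingIdeal R M j ≤ RingHom.ker σ := Iff.rfl
  rw [hspan, fittingIdeal, Ideal.span_le]
  have hdet {m n s : ℕ} (A : Matrix (Fin n) (Fin m) R) (a : Fin s → Fin n) (b : Fin s → Fin m) :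
      σ (A.submatrix a b).det = ((A.map σ).submatrix a b).det := by
    rw [RingHom.map_det]; rfl
  constructor
  · intro h
    -- One presentation suffices here; the converse must treat all of them, as the generating set of
    -- the ideal does.
    obtain ⟨m, n, A, π, hπ, hA⟩ := exists_presentation (R := R) M
    have h1 := finrank_semilinear_add_rank σ hπ hA
    have h2 := (forall_minors_eq_zero_iff (n + 1 - j) (A.map σ)).1 fun a b => by
      rw [← hdet]
      exact h ⟨m, n, A, π, hπ, hA, a, b, rfl⟩
    -- Truncation in `n + 1 - j` is harmless: for `j > n` the bound would read `rank < 0`.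
    omega
  · rintro h _ ⟨m, n, A, π, hπ, hA, a, b, rfl⟩
    have h1 := finrank_semilinear_add_rank σ hπ hA
    change σ _ = 0
    rw [hdet]
    exact (forall_minors_eq_zero_iff (n + 1 - j) (A.map σ)).2 (by omega) a b

end Fitting

instance (r : ℕ) : IsNoetherianRing (LaurentRing r) := by
  have : Algebra.FiniteType ℂ (LaurentRing r) := inferInstance
  exact Algebra.FiniteType.isNoetherianRing ℂ _

/-- The indices `j` with `P` in the `j`-th variety form an initial segment ending at the fibre
dimension, so the supremum is a true maximum. -/
theorem depth_eq_finrank {G : Type*} [Group G] {r : ℕ} (φ : G →* FreeAb r)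
    (hφ : Function.Surjective φ) [Module.Finite (LaurentRing r) (AlexanderModule φ hφ)]
    (P : Fin r → ℂˣ) :
    depth φ hφ P =
      Module.finrank ℂ (AlexanderModule φ hφ →ₛₗ[(evalTorus P : LaurentRing r →+* ℂ)] ℂ) := by
  have : {j : ℕ | P ∈ charVariety φ hφ j} = Set.Iic (Module.finrank ℂ
      (AlexanderModule φ hφ →ₛₗ[(evalTorus P : LaurentRing r →+* ℂ)] ℂ)) := by
    ext j
    exact forall_fittingIdeal_eq_zero_iff (AlexanderModule φ hφ)
      (evalTorus P : LaurentRing r →+* ℂ) j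
  rw [depth, this, csSup_Iic]

/-! ### Homomorphisms to `ℂ` that are equivariant for a character. -/

section EquivariantHoms

variable {G : Type*} [Group G]

/-- The homomorphisms `N → ℂ` on which conjugation by `G` acts through the character `χ`. -/
def eqvHoms (N : Subgroup G) [N.Normal] (χ : G →* ℂ) : Submodule ℂ (N → ℂ) where
  carrier := {f | (∀ a b, f (a * b) = f a + f b) ∧
    ∀ g x, f (MulAut.conjNormal g x) = χ g * f x}
  add_mem' {f f'} hf hf' :=
    ⟨fun a b => by simp only [Pi.add_apply, hf.1, hf'.1]; ring,
      fun g x => by simp only [Pi.add_apply, hf.2, hf'.2]; ring⟩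
  zero_mem' := by simp
  smul_mem' t f hf :=
    ⟨fun a b => by simp only [Pi.smul_apply, smul_eq_mul, hf.1]; ring,
      fun g x => by simp only [Pi.smul_apply, smul_eq_mul, hf.2]; ring⟩

theorem map_one_of_additive {f : G → ℂ} (hf : ∀ a b, f (a * b) = f a + f b) : f 1 = 0 := by
  have := hf 1 1
  rw [mul_one] at this
  linear_combination -this

theorem map_inv_of_additive {f : G → ℂ} (hf : ∀ a b, f (a * b) = f a + f b) (a : G) :
    f a⁻¹ = -f a := by
  have := hf a a⁻¹
  rw [mul_inv_cancel, map_one_of_additive hf] at this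
  linear_combination -this

theorem map_pow_of_additive {f : G → ℂ} (hf : ∀ a b, f (a * b) = f a + f b) (a : G) (d : ℕ) :
    f (a ^ d) = d * f a := by
  induction d with
  | zero => simp [map_one_of_additive hf]
  | succ d ih => rw [pow_succ, hf, ih]; push_cast; ring

theorem map_conj_of_additive {N : Subgroup G} [N.Normal] {f : N → ℂ}
    (hf : ∀ a b, f (a * b) = f a + f b) (m x : N) : f (MulAut.conjNormal (m : G) x) = f x := by
  have : MulAut.conjNormal (m : G) x = m * x * m⁻¹ := by ext; simp
  rw [this, hf, hf, map_inv_of_additive hf]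
  ring

variable {K N : Subgroup G} [K.Normal] [N.Normal]

/-- Restriction of equivariant homomorphisms to a smaller normal subgroup. -/
def eqvRestrict (h : K ≤ N) (χ : G →* ℂ) : eqvHoms N χ →ₗ[ℂ] eqvHoms K χ where
  toFun f := ⟨fun x => f.1 (Subgroup.inclusion h x),
      fun a b => f.2.1 (Subgroup.inclusion h a) (Subgroup.inclusion h b),
      fun g x => f.2.2 g (Subgroup.inclusion h x)⟩
  map_add' _ _ := rfl
  map_smul' _ _ := rfl

section Nontrivial

variable (h : K ≤ N) {χ : G →* ℂ}

/-- `f [g₀, x] = (χ g₀ - 1) f x`, and the commutator lies in `K`. -/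
theorem eqvRestrict_injective (hcomm : ∀ a b : G, a * b * a⁻¹ * b⁻¹ ∈ K)
    {g₀ : G} (hg₀ : χ g₀ ≠ 1) :
    Function.Injective (eqvRestrict h χ) := by
  rw [injective_iff_map_eq_zero]
  intro f hf
  ext x
  have h1 : f.1 (MulAut.conjNormal g₀ x * x⁻¹) = 0 :=
    congrFun (congrArg Subtype.val hf) ⟨g₀ * x * g₀⁻¹ * (x : G)⁻¹, hcomm g₀ x⟩
  rw [f.2.1, f.2.2, map_inv_of_additive f.2.1] at h1
  have h2 : (χ g₀ - 1) * f.1 x = 0 := by linear_combination h1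
  exact (mul_eq_zero.1 h2).resolve_left (sub_ne_zero.2 hg₀)

/-- The crossed homomorphism `x ↦ f [g₀, x]`. -/
def commutatorValue (hcomm : ∀ a b : G, a * b * a⁻¹ * b⁻¹ ∈ K)
    (f : K → ℂ) (g₀ x : G) : ℂ := f ⟨g₀ * x * g₀⁻¹ * x⁻¹, hcomm g₀ x⟩

/-- This is the identity `[g₀, xy] = [g₀, x] · x [g₀, y] x⁻¹`. -/
theorem commutatorValue_mul (hcomm : ∀ a b : G, a * b * a⁻¹ * b⁻¹ ∈ K)
    (f : eqvHoms K χ) (g₀ x y : G) :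
    commutatorValue hcomm f.1 g₀ (x * y) =
      commutatorValue hcomm f.1 g₀ x + χ x * commutatorValue hcomm f.1 g₀ y := by
  unfold commutatorValue
  rw [← f.2.2, ← f.2.1]
  refine congrArg f.1 (Subtype.ext ?_)
  simp only [Subgroup.coe_mul, MulAut.conjNormal_apply]
  group

/-- The value at `(g x g⁻¹) g = g x` is computed in two ways. -/
theorem commutatorValue_conj (hcomm : ∀ a b : G, a * b * a⁻¹ * b⁻¹ ∈ K)
    (f : eqvHoms K χ) (g₀ g x : G) (hx : χ x = 1) :
    commutatorValue hcomm f.1 g₀ (g * x * g⁻¹) = χ g * commutatorValue hcomm f.1 g₀ x := by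
  have h1 := commutatorValue_mul hcomm f g₀ (g * x * g⁻¹) g
  rw [show g * x * g⁻¹ * g = g * x by group, commutatorValue_mul] at h1
  have h2 : χ (g * x * g⁻¹) = 1 := by
    rw [map_mul, map_mul, hx, mul_one, ← map_mul, mul_inv_cancel, map_one]
  rw [h2] at h1
  linear_combination -h1

/-- The extension `x ↦ (χ g₀ - 1)⁻¹ f [g₀, x]` is the one forced by injectivity. It is additive on
`N` because the crossed homomorphism has no twist where `χ = 1`. -/
theorem eqvRestrict_surjective (hcomm : ∀ a b : G, a * b * a⁻¹ * b⁻¹ ∈ K)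
    {g₀ : G} (hg₀ : χ g₀ ≠ 1) (hN : ∀ x ∈ N, χ x = 1) :
    Function.Surjective (eqvRestrict h χ) := by
  intro f
  have h0 : χ g₀ - 1 ≠ 0 := sub_ne_zero.2 hg₀
  refine ⟨⟨fun x => (χ g₀ - 1)⁻¹ * commutatorValue hcomm f.1 g₀ x,
    fun a b => ?_, fun g x => ?_⟩, ?_⟩
  · beta_reduce
    rw [Subgroup.coe_mul, commutatorValue_mul, hN a a.2]
    ring
  · beta_reduce
    rw [MulAut.conjNormal_apply, commutatorValue_conj hcomm f g₀ g x (hN x x.2)]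
    ring
  · ext k
    have h1 : commutatorValue hcomm f.1 g₀ (k : G) = f.1 (MulAut.conjNormal g₀ k * k⁻¹) := rfl
    change (χ g₀ - 1)⁻¹ * commutatorValue hcomm f.1 g₀ (k : G) = f.1 k
    rw [h1, f.2.1, f.2.2, map_inv_of_additive f.2.1]
    field_simp
    ring

/-- For a nontrivial character, equivariant homomorphisms extend uniquely from `K` to `N`. -/
def eqvEquiv (hcomm : ∀ a b : G, a * b * a⁻¹ * b⁻¹ ∈ K)
    {g₀ : G} (hg₀ : χ g₀ ≠ 1) (hN : ∀ x ∈ N, χ x = 1) : eqvHoms N χ ≃ₗ[ℂ] eqvHoms K χ :=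
  LinearEquiv.ofBijective (eqvRestrict h χ)
    ⟨eqvRestrict_injective h hcomm hg₀, eqvRestrict_surjective h hcomm hg₀ hN⟩

end Nontrivial

section Trivial

variable (N)

/-- Restriction of homomorphisms to a normal subgroup. -/
def addHomsRestrict : addHoms G →ₗ[ℂ] eqvHoms N 1 where
  toFun f := ⟨fun x => f.1 x, fun a b => f.2 a b, fun g x => by
    change f.1 (g * x * g⁻¹) = _ * f.1 x
    rw [f.2, f.2, map_inv_of_additive f.2, MonoidHom.one_apply]
    ring⟩
  map_add' _ _ := rfl
  map_smul' _ _ := rfl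

variable {N} {d : ℕ}

theorem addHomsRestrict_injective (hd : d ≠ 0) (hpow : ∀ g : G, g ^ d ∈ N) :
    Function.Injective (addHomsRestrict N) := by
  rw [injective_iff_map_eq_zero]
  intro f hf
  ext g
  have h1 : f.1 (g ^ d) = 0 := congrFun (congrArg Subtype.val hf) ⟨g ^ d, hpow g⟩
  rw [map_pow_of_additive f.2] at h1
  exact (mul_eq_zero.1 h1).resolve_left (by exact_mod_cast hd)

/-- For the trivial character `x ↦ f [a, x]` is a homomorphism on `G`. It vanishes at `b ^ d ∈ N` by
invariance of `f`, hence at `b`. -/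
theorem commutatorValue_eq_zero (hcomm : ∀ a b : G, a * b * a⁻¹ * b⁻¹ ∈ N)
    (hd : d ≠ 0) (hpow : ∀ g : G, g ^ d ∈ N) (f : eqvHoms N 1) (a b : G) :
    commutatorValue hcomm f.1 a b = 0 := by
  have h1 : ∀ x y, commutatorValue hcomm f.1 a (x * y) =
      commutatorValue hcomm f.1 a x + commutatorValue hcomm f.1 a y := fun x y => by
    simpa using commutatorValue_mul hcomm f a x y
  have h2 : commutatorValue hcomm f.1 a (b ^ d) = 0 := by
    have : commutatorValue hcomm f.1 a (b ^ d) =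
      f.1 (MulAut.conjNormal a (⟨b ^ d, hpow b⟩ : N) * (⟨b ^ d, hpow b⟩ : N)⁻¹) := rfl
    rw [this, f.2.1, f.2.2, map_inv_of_additive f.2.1]
    simp
  rw [map_pow_of_additive h1] at h2
  exact (mul_eq_zero.1 h2).resolve_left (by exact_mod_cast hd)

/-- The extension is `g ↦ d⁻¹ f (g ^ d)`. Its additivity comes from `(ab) ^ d = a ^ d b ^ d` modulo
the kernel `H` of `f`: the quotient `G ⧸ H` is abelian since `f` kills commutators. -/
theorem addHomsRestrict_surjective (hcomm : ∀ a b : G, a * b * a⁻¹ * b⁻¹ ∈ N)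
    (hd : d ≠ 0) (hpow : ∀ g : G, g ^ d ∈ N) :
    Function.Surjective (addHomsRestrict N) := by
  intro f
  let H : Subgroup G :=
    { carrier := {x | ∃ hx : x ∈ N, f.1 ⟨x, hx⟩ = 0}
      mul_mem' := by
        rintro x y ⟨hx, hx0⟩ ⟨hy, hy0⟩
        exact ⟨mul_mem hx hy, (f.2.1 ⟨x, hx⟩ ⟨y, hy⟩).trans (by rw [hx0, hy0, add_zero])⟩
      one_mem' := ⟨one_mem N, map_one_of_additive f.2.1⟩
      inv_mem' := by
        rintro x ⟨hx, hx0⟩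
        exact ⟨inv_mem hx, (map_inv_of_additive f.2.1 ⟨x, hx⟩).trans (by rw [hx0, neg_zero])⟩ }
  have hH : H.Normal := ⟨by
    rintro x ⟨hx, hx0⟩ g
    exact ⟨Subgroup.Normal.conj_mem inferInstance x hx g,
      (f.2.2 g ⟨x, hx⟩).trans (by rw [hx0, mul_zero])⟩⟩
  have hcH (a b : G) : Commute (a : G ⧸ H) (b : G ⧸ H) := by
    refine (QuotientGroup.eq (s := H)).2 ?_
    have : (a * b)⁻¹ * (b * a) = b⁻¹ * a⁻¹ * (b⁻¹)⁻¹ * (a⁻¹)⁻¹ := by group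
    rw [this]
    exact ⟨hcomm _ _, commutatorValue_eq_zero hcomm hd hpow f _ _⟩
  have hd' : (d : ℂ) ≠ 0 := by exact_mod_cast hd
  refine ⟨⟨fun g => (d : ℂ)⁻¹ * f.1 ⟨g ^ d, hpow g⟩, fun a b => ?_⟩, ?_⟩
  · have h1 : (((a * b) ^ d : G) : G ⧸ H) = ((a ^ d * b ^ d : G) : G ⧸ H) := by
      simpa using (hcH a b).mul_pow d
    obtain ⟨h2, h3⟩ := (QuotientGroup.eq (s := H)).1 h1
    have h4 := f.2.1 (⟨(a * b) ^ d, hpow _⟩⁻¹) (⟨a ^ d, hpow a⟩ * ⟨b ^ d, hpow b⟩)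
    rw [f.2.1 ⟨a ^ d, hpow a⟩, map_inv_of_additive f.2.1] at h4
    have h5 := h4.symm.trans h3
    linear_combination -(d : ℂ)⁻¹ * h5
  · ext x
    change (d : ℂ)⁻¹ * f.1 (x ^ d) = f.1 x
    rw [map_pow_of_additive f.2.1]
    field_simp

/-- Invariant homomorphisms on a normal subgroup with finite abelian quotient extend uniquely. -/
def addHomsEquiv (hcomm : ∀ a b : G, a * b * a⁻¹ * b⁻¹ ∈ N)
    (hd : d ≠ 0) (hpow : ∀ g : G, g ^ d ∈ N) : addHoms G ≃ₗ[ℂ] eqvHoms N 1 :=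
  LinearEquiv.ofBijective (addHomsRestrict N)
    ⟨addHomsRestrict_injective hd hpow, addHomsRestrict_surjective hcomm hd hpow⟩

end Trivial

section Decomposition

variable {B : Type*} [AddCommGroup B] (π : G →* Multiplicative B)

/-- The character of `G` given by a character of a quotient. -/
def quotChar (ψ : AddChar B ℂ) : G →* ℂ := ψ.toMonoidHom.comp π

theorem quotChar_apply (ψ : AddChar B ℂ) (g : G) : quotChar π ψ g = ψ (π g).toAdd := rfl

theorem map_conj_eq_of_map_eq {f : π.ker → ℂ} (hf : ∀ a b, f (a * b) = f a + f b) {g g' : G}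
    (h : π g = π g') (x : π.ker) :
    f (MulAut.conjNormal g x) = f (MulAut.conjNormal g' x) := by
  have hm : g * g'⁻¹ ∈ π.ker := by simp [MonoidHom.mem_ker, h]
  have h1 := map_conj_of_additive hf ⟨g * g'⁻¹, hm⟩ (MulAut.conjNormal g' x)
  rw [← h1, ← MulAut.mul_apply, ← map_mul]
  simp

variable [Fintype B]

/-- The sum of a family of equivariant homomorphisms. -/
def eqvSum : (∀ ψ : AddChar B ℂ, eqvHoms π.ker (quotChar π ψ)) →ₗ[ℂ] addHoms π.ker where
  toFun v := ⟨∑ ψ, (v ψ).1, fun a b => by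
    simp only [Finset.sum_apply, ← Finset.sum_add_distrib]
    exact Finset.sum_congr rfl fun ψ _ => (v ψ).2.1 a b⟩
  map_add' v w := by
    ext x
    simp [Finset.sum_add_distrib]
  map_smul' t v := by
    ext x
    simp [Finset.mul_sum]

theorem eqvSum_apply (v : ∀ ψ : AddChar B ℂ, eqvHoms π.ker (quotChar π ψ)) (x : π.ker) :
    (eqvSum π v).1 x = ∑ ψ, (v ψ).1 x := by simp [eqvSum]

/-- Evaluating a vanishing sum at the conjugates of `x` by representatives of `B` weights the terms
by `θ b`; orthogonality of characters isolates each term. -/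
theorem eqvSum_injective (hπ : Function.Surjective π) : Function.Injective (eqvSum π) := by
  classical
  rw [injective_iff_map_eq_zero]
  intro v hv
  ext ψ x
  choose s hs using fun b : B => hπ (Multiplicative.ofAdd b)
  have h1 (b : B) : ∑ θ : AddChar B ℂ, θ b * (v θ).1 x = 0 := by
    have h2 := eqvSum_apply π v (MulAut.conjNormal (s b) x)
    rw [hv] at h2
    refine Eq.trans (Finset.sum_congr rfl fun θ _ => ?_) h2.symm
    rw [(v θ).2.2, quotChar_apply, hs]
    rfl
  have h3 : ∑ b : B, ψ (-b) * ∑ θ : AddChar B ℂ, θ b * (v θ).1 x = 0 := by simp [h1]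
  simp only [Finset.mul_sum] at h3
  rw [Finset.sum_comm] at h3
  have h4 (θ : AddChar B ℂ) : ∑ b : B, ψ (-b) * (θ b * (v θ).1 x) =
      if θ = ψ then (Fintype.card B : ℂ) * (v θ).1 x else 0 := by
    have h5 := AddChar.sum_eq_ite (θ - ψ)
    simp only [sub_eq_zero] at h5
    rw [← zero_mul ((v θ).1 x), ← ite_mul, ← h5, Finset.sum_mul]
    refine Finset.sum_congr rfl fun b _ => ?_
    rw [AddChar.sub_apply]
    ring
  simp only [h4, Finset.sum_ite_eq', Finset.mem_univ, if_true] at h3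
  exact (mul_eq_zero.1 h3).resolve_left (by exact_mod_cast Fintype.card_ne_zero)

/-- The components are the averages `|B|⁻¹ ∑ ψ(-b) f(s_b x s_b⁻¹)`. They do not depend on the
representatives `s_b`, because inner automorphisms of the kernel leave `f` unchanged. -/
theorem eqvSum_surjective (hπ : Function.Surjective π) : Function.Surjective (eqvSum π) := by
  classical
  intro f
  choose s hs using fun b : B => hπ (Multiplicative.ofAdd b)
  have hB : (Fintype.card B : ℂ) ≠ 0 := by exact_mod_cast Fintype.card_ne_zero
  refine ⟨fun ψ => ⟨fun x => (Fintype.card B : ℂ)⁻¹ *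
    ∑ b : B, ψ (-b) * f.1 (MulAut.conjNormal (s b) x), fun a b => ?_, fun g x => ?_⟩, ?_⟩
  · beta_reduce
    rw [← mul_add, ← Finset.sum_add_distrib]
    congr 1
    refine Finset.sum_congr rfl fun c _ => ?_
    rw [map_mul, f.2, mul_add]
  · beta_reduce
    rw [mul_left_comm]
    congr 1
    rw [Finset.mul_sum]
    -- Translating the index by the image of `g` replaces `s b * g` by the representative of its
    -- class.
    refine Eq.trans ?_ (Equiv.sum_comp (Equiv.addRight (π g).toAdd) _)
    refine Finset.sum_congr rfl fun b _ => ?_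
    rw [Equiv.coe_addRight, ← MulAut.mul_apply, ← map_mul, quotChar_apply, ← mul_assoc,
      ← AddChar.map_add_eq_mul]
    congr 1
    · rw [neg_add_rev, add_neg_cancel_left]
    · refine map_conj_eq_of_map_eq π f.2 ?_ x
      rw [map_mul, hs, hs]
      rfl
  · ext x
    rw [eqvSum_apply]
    simp only [← Finset.mul_sum]
    rw [Finset.sum_comm]
    -- Summing over all characters leaves only the term `b = 0`.
    simp only [← Finset.sum_mul, AddChar.sum_apply_eq_ite]
    simp only [neg_eq_zero, ite_mul, zero_mul, Finset.sum_ite_eq', Finset.mem_univ, if_true]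
    rw [inv_mul_cancel_left₀ hB]
    have := map_conj_eq_of_map_eq π f.2 (g := s 0) (g' := 1) (by rw [hs]; simp) x
    simpa using this

/-- The homomorphisms from the kernel of a surjection onto a finite abelian group decompose
according to the characters of the quotient. -/
def eqvDecomposition (hπ : Function.Surjective π) :
    (∀ ψ : AddChar B ℂ, eqvHoms π.ker (quotChar π ψ)) ≃ₗ[ℂ] addHoms π.ker :=
  LinearEquiv.ofBijective (eqvSum π) ⟨eqvSum_injective π hπ, eqvSum_surjective π hπ⟩

end Decomposition

end EquivariantHoms

/-! ### Fibres of the Alexander module as equivariant homomorphisms. -/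

section Alexander

variable {G : Type*} [Group G] {r : ℕ} (φ : G →* FreeAb r) (hφ : Function.Surjective φ)

/-- The class of an element of `Ker φ` in the Alexander invariant. -/
def alexanderClass (k : φ.ker) : AlexanderSpace φ :=
  (1 : ℂ) ⊗ₜ[ℤ] Additive.ofMul (Abelianization.of k)

theorem alexanderClass_mul (a b : φ.ker) :
    alexanderClass φ (a * b) = alexanderClass φ a + alexanderClass φ b := by
  simp [alexanderClass, TensorProduct.tmul_add]

theorem alexanderRep_apply (g : G) : alexanderRep φ hφ (φ g) = conjRep φ g := by
  have : (QuotientGroup.quotientKerEquivOfSurjective φ hφ).symm (φ g) = (g : G ⧸ φ.ker) := by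
    rw [MulEquiv.symm_apply_eq]; rfl
  change QuotientGroup.lift φ.ker (conjRep φ) (fun g hg => conjRep_ker φ g hg)
    ((QuotientGroup.quotientKerEquivOfSurjective φ hφ).symm (φ g)) = _
  rw [this]
  rfl

theorem conjRep_alexanderClass (g : G) (k : φ.ker) :
    conjRep φ g (alexanderClass φ k) = alexanderClass φ (MulAut.conjNormal g k) := by
  simp [conjRep, alexanderClass]

theorem alexanderSpace_hom_ext {l l' : AlexanderSpace φ →ₗ[ℂ] ℂ}
    (h : ∀ k, l (alexanderClass φ k) = l' (alexanderClass φ k)) : l = l' := by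
  ext x
  induction x using Additive.rec with
  | ofMul x =>
    induction x using QuotientGroup.induction_on with
    | H x => exact h x

/-- The linear form on the Alexander invariant given by a homomorphism on `Ker φ`. -/
def alexanderForm (f : addHoms φ.ker) : AlexanderSpace φ →ₗ[ℂ] ℂ :=
  LinearMap.liftBaseChange ℂ (MonoidHom.toAdditiveLeft (Abelianization.lift
    ({ toFun := fun k => Multiplicative.ofAdd (f.1 k)
       map_one' := by rw [map_one_of_additive f.2]; rfl
       map_mul' := fun a b => by rw [f.2]; rfl } :
      φ.ker →* Multiplicative ℂ))).toIntLinearMap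

theorem alexanderForm_class (f : addHoms φ.ker) (k : φ.ker) :
    alexanderForm φ f (alexanderClass φ k) = f.1 k := by
  simp [alexanderForm, alexanderClass]

variable (P : Fin r → ℂˣ)

/-- Semilinear forms on the Alexander module restrict to equivariant homomorphisms on `Ker φ`. -/
def semilinearToEqv :
    (AlexanderModule φ hφ →ₛₗ[(evalTorus P : LaurentRing r →+* ℂ)] ℂ) →ₗ[ℂ]
      eqvHoms φ.ker ((torusChar P).comp φ) where
  toFun l := ⟨fun k => l ((alexanderRep φ hφ).asModuleEquiv.symm (alexanderClass φ k)),
    fun a b => by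
      beta_reduce
      rw [alexanderClass_mul, map_add, map_add],
    fun g k => by
      beta_reduce
      rw [← conjRep_alexanderClass, ← alexanderRep_apply φ hφ,
        Representation.asModuleEquiv_symm_map_rho, LinearMap.map_smulₛₗ]
      simp [evalTorus]⟩
  map_add' _ _ := rfl
  map_smul' _ _ := rfl

/-- A semilinear form is `ℂ`-linear, since evaluation at `P` is a `ℂ`-algebra map, and the classes
of elements of `Ker φ` span the Alexander space. -/
theorem semilinearToEqv_injective : Function.Injective (semilinearToEqv φ hφ P) := by
  rw [injective_iff_map_eq_zero]
  intro l hl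
  let l' : AlexanderSpace φ →ₗ[ℂ] ℂ :=
    { toFun := fun v => l ((alexanderRep φ hφ).asModuleEquiv.symm v)
      map_add' := fun v w => by rw [map_add, map_add]
      map_smul' := fun t v => by
        rw [Representation.asModuleEquiv_symm_map_smul, LinearMap.map_smulₛₗ]
        exact congrArg (· • _) ((evalTorus P).commutes t) }
  have h : l' = 0 := alexanderSpace_hom_ext φ fun k => congrFun (congrArg Subtype.val hl) k
  ext m
  exact LinearMap.congr_fun h ((alexanderRep φ hφ).asModuleEquiv m)

/-- The homomorphism extends to a linear form `L` on the Alexander space. Its equivariance passes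
from generators to all vectors, then from group elements to the group ring. -/
theorem semilinearToEqv_surjective : Function.Surjective (semilinearToEqv φ hφ P) := by
  intro f
  let L := alexanderForm φ ⟨f.1, f.2.1⟩
  have hL (t : FreeAb r) (v : AlexanderSpace φ) :
      L (alexanderRep φ hφ t v) = torusChar P t * L v := by
    obtain ⟨g, rfl⟩ := hφ t
    rw [alexanderRep_apply]
    have : L ∘ₗ conjRep φ g = torusChar P (φ g) • L := alexanderSpace_hom_ext φ fun k => by
      simp only [LinearMap.comp_apply, LinearMap.smul_apply, conjRep_alexanderClass, L,
        alexanderForm_class, smul_eq_mul]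
      exact f.2.2 g k
    exact LinearMap.congr_fun this v
  have hF (F : LaurentRing r) (v : AlexanderSpace φ) :
      L ((alexanderRep φ hφ).asAlgebraHom F v) = evalTorus P F * L v := by
    induction F using MonoidAlgebra.induction_on with
    | of t => simpa [evalTorus] using hL t v
    | add x y hx hy => rw [map_add, map_add, LinearMap.add_apply, map_add, hx, hy, add_mul]
    | smul t x hx =>
      rw [map_smul, map_smul, LinearMap.smul_apply, map_smul, hx, smul_eq_mul, smul_eq_mul,
        mul_assoc]
  refine ⟨{ toFun := fun m => L ((alexanderRep φ hφ).asModuleEquiv m)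
            map_add' := fun x y => by rw [map_add, map_add]
            map_smul' := fun F x => by
              rw [Representation.asModuleEquiv_map_smul, hF]
              rfl }, ?_⟩
  ext k
  exact alexanderForm_class φ ⟨f.1, f.2.1⟩ k

/-- Equivariant homomorphisms on `Ker φ` are the semilinear forms on the Alexander module. -/
def semilinearEquivEqv :
    (AlexanderModule φ hφ →ₛₗ[(evalTorus P : LaurentRing r →+* ℂ)] ℂ) ≃ₗ[ℂ]
      eqvHoms φ.ker ((torusChar P).comp φ) :=
  LinearEquiv.ofBijective (semilinearToEqv φ hφ P)
    ⟨semilinearToEqv_injective φ hφ P, semilinearToEqv_surjective φ hφ P⟩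

theorem finite_eqvHoms (hφ : Function.Surjective φ)
    [Module.Finite (LaurentRing r) (AlexanderModule φ hφ)] :
    Module.Finite ℂ (eqvHoms φ.ker ((torusChar P).comp φ)) := by
  obtain ⟨n, π, hπ⟩ := Module.Finite.exists_fin' (LaurentRing r) (AlexanderModule φ hφ)
  have := finite_semilinear (evalTorus P : LaurentRing r →+* ℂ) hπ
  exact Module.Finite.equiv (semilinearEquivEqv φ hφ P)

theorem finrank_eqvHoms [Module.Finite (LaurentRing r) (AlexanderModule φ hφ)] :
    Module.finrank ℂ (eqvHoms φ.ker ((torusChar P).comp φ)) = depth φ hφ P := by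
  rw [depth_eq_finrank, (semilinearEquivEqv φ hφ P).finrank_eq]

theorem torusChar_one : torusChar (1 : Fin r → ℂˣ) = 1 := by
  ext t
  simp [torusChar]

/-- A homomorphism on `G` is determined by its restriction to `Ker φ`, which lies in the dual of the
fibre at the trivial point, and by its values on lifts of the basis of `ℤ^r`. -/
theorem finite_addHoms (hφ : Function.Surjective φ)
    [Module.Finite (LaurentRing r) (AlexanderModule φ hφ)] : Module.Finite ℂ (addHoms G) := by
  have h1 := finite_eqvHoms φ 1 hφ
  rw [torusChar_one] at h1
  choose g hg using fun i : Fin r => hφ (Multiplicative.ofAdd (Pi.single i 1))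
  let Λ : addHoms G →ₗ[ℂ] eqvHoms φ.ker 1 × (Fin r → ℂ) :=
    (addHomsRestrict φ.ker).prod
      { toFun := fun f i => f.1 (g i)
        map_add' := fun _ _ => rfl
        map_smul' := fun _ _ => rfl }
  have h2 : Module.Finite ℂ (eqvHoms φ.ker 1) := h1
  refine Module.Finite.of_injective Λ ?_
  rw [injective_iff_map_eq_zero]
  intro f hf
  obtain ⟨hf1, hf2⟩ := Prod.ext_iff.1 hf
  let H : Subgroup G :=
    { carrier := {x | f.1 x = 0}
      mul_mem' := fun {a b} ha hb => by
        change f.1 _ = 0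
        rw [f.2, ha, hb, add_zero]
      one_mem' := map_one_of_additive f.2
      inv_mem' := fun {a} ha => by
        change f.1 _ = 0
        rw [map_inv_of_additive f.2, ha, neg_zero] }
  have hK : φ.ker ≤ H := fun k hk => congrFun (congrArg Subtype.val hf1) ⟨k, hk⟩
  have hmap : H.map φ = ⊤ := by
    rw [eq_top_iff]
    intro t _
    have ht : t = ∏ i, φ (g i) ^ (t.toAdd i) := by
      simp only [hg]
      refine Multiplicative.toAdd.injective (funext fun j => ?_)
      simp [toAdd_prod, Finset.sum_apply, Pi.single_apply]
    rw [ht]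
    exact Subgroup.prod_mem _ fun i _ =>
      Subgroup.zpow_mem _ (Subgroup.mem_map_of_mem _ (congrFun hf2 i)) _
  have hH : H = ⊤ := by
    have := Subgroup.comap_map_eq_self hK
    rw [hmap, Subgroup.comap_top] at this
    exact this.symm
  ext x
  have hx : x ∈ H := hH ▸ Subgroup.mem_top x
  exact hx

end Alexander

/-! ### Characters of `⊕ ℤ/n_i` and roots of unity. -/

section Reduction

variable {r : ℕ} (n : Fin r → ℕ)

theorem reductionMod_surjective : Function.Surjective (reductionMod n) := by
  intro b
  choose t ht using fun i => ZMod.intCast_surjective (b.toAdd i)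
  exact ⟨Multiplicative.ofAdd t, Multiplicative.toAdd.injective (funext ht)⟩

/-- The point of the torus given by a character of `⊕ ℤ/n_i`. -/
def charPoint (ψ : AddChar (∀ i, ZMod (n i)) ℂ) (i : Fin r) : ℂˣ :=
  ψ.toMonoidHom.toHomUnits (Multiplicative.ofAdd (Pi.single i 1))

theorem torusChar_charPoint (ψ : AddChar (∀ i, ZMod (n i)) ℂ) :
    torusChar (charPoint n ψ) = ψ.toMonoidHom.comp (reductionMod n) := by
  refine MonoidHom.ext fun t => ?_
  have ht : reductionMod n t =
      ∏ i, (Multiplicative.ofAdd (Pi.single i 1 : ∀ i, ZMod (n i))) ^ (t.toAdd i) := by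
    refine Multiplicative.toAdd.injective (funext fun j => ?_)
    rw [toAdd_prod, Finset.sum_apply, Finset.sum_eq_single j
      (fun i _ hij => by simp [Pi.single_eq_of_ne hij.symm]) (by simp)]
    simp [reductionMod]
  have h1 : (torusChar (charPoint n ψ)) t =
      ((ψ.toMonoidHom.toHomUnits (reductionMod n t) : ℂˣ) : ℂ) := by
    rw [ht, map_prod]
    simp only [map_zpow]
    rfl
  rw [h1]
  rfl

theorem charPoint_injective : Function.Injective (charPoint n) := by
  intro ψ θ h
  have h1 := (torusChar_charPoint n ψ).symm.trans ((congrArg torusChar h).trans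
    (torusChar_charPoint n θ))
  ext b
  obtain ⟨t, ht⟩ := reductionMod_surjective n (Multiplicative.ofAdd b)
  have h2 := DFunLike.congr_fun h1 t
  rw [MonoidHom.comp_apply, MonoidHom.comp_apply, ht] at h2
  exact h2

theorem charPoint_zero : charPoint n 0 = 1 := by
  ext i
  simp [charPoint]

/-- If `ω i ^ n i = 1` for all `i`, the character of `ℤ^r` given by `ω` kills the kernel of
reduction and so descends to the finite quotient. -/
theorem charPoint_image :
    charPoint n '' {ψ | ψ ≠ 0} = {ω : Fin r → ℂˣ | (∀ i, ω i ^ n i = 1) ∧ ω ≠ 1} := by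
  ext ω
  constructor
  · rintro ⟨ψ, hψ, rfl⟩
    refine ⟨fun i => ?_, fun h => hψ (charPoint_injective n (h.trans (charPoint_zero n).symm))⟩
    rw [charPoint, ← map_pow, ← ofAdd_nsmul, ← Pi.single_smul]
    simp
  · rintro ⟨h1, h2⟩
    let T : FreeAb r →* ℂˣ := (torusChar ω).toHomUnits
    have hT : (reductionMod n).ker ≤ T.ker := by
      intro t ht
      rw [MonoidHom.mem_ker] at ht ⊢
      refine Units.ext ?_
      change ((∏ i, ω i ^ (t.toAdd i) : ℂˣ) : ℂ) = 1
      rw [Finset.prod_eq_one, Units.val_one]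
      intro i _
      have hi : ((t.toAdd i : ℤ) : ZMod (n i)) = 0 := congrFun (congrArg Multiplicative.toAdd ht) i
      obtain ⟨q, hq⟩ := (ZMod.intCast_zmod_eq_zero_iff_dvd _ _).1 hi
      rw [hq, zpow_mul, zpow_natCast, h1, one_zpow]
    let T' : Multiplicative (∀ i, ZMod (n i)) →* ℂˣ :=
      (reductionMod n).liftOfSurjective (reductionMod_surjective n) ⟨T, hT⟩
    have hT' (t : FreeAb r) : T' (reductionMod n t) = T t :=
      MonoidHom.liftOfRightInverse_comp_apply _ _ _ ⟨T, hT⟩ t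
    let ψ : AddChar (∀ i, ZMod (n i)) ℂ := AddChar.toMonoidHomEquiv.symm
      ((Units.coeHom ℂ).comp T')
    have hψ : charPoint n ψ = ω := by
      funext i
      refine Units.ext ?_
      change ((T' (Multiplicative.ofAdd (Pi.single i 1)) : ℂˣ) : ℂ) = _
      have : Multiplicative.ofAdd (Pi.single i 1 : ∀ i, ZMod (n i)) =
          reductionMod n (Multiplicative.ofAdd (Pi.single i 1)) := by
        refine Multiplicative.toAdd.injective (funext fun j => ?_)
        by_cases hij : j = i
        · subst hij; simp [reductionMod]
        · simp [reductionMod, hij]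
      rw [this, hT']
      change ((∏ j, ω j ^ ((Pi.single i 1 : Fin r → ℤ) j) : ℂˣ) : ℂ) = _
      rw [Finset.prod_eq_single i (fun j _ hj => by simp [hj]) (by simp)]
      simp
    refine ⟨ψ, fun h => h2 ?_, hψ⟩
    rw [← hψ, h, charPoint_zero]

end Reduction

/-! ### Dimension count for the kernel of the reduction. -/

section Covers

variable {G : Type*} [Group G] {r : ℕ} (φ : G →* FreeAb r) (hφ : Function.Surjective φ)
  [Module.Finite (LaurentRing r) (AlexanderModule φ hφ)] (n : Fin r → ℕ)

theorem finite_finrank_eqvHoms_reduction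
    (ψ : AddChar (∀ i, ZMod (n i)) ℂ) (hψ : ψ ≠ 0) :
    Module.Finite ℂ (eqvHoms ((reductionMod n).comp φ).ker
      (quotChar ((reductionMod n).comp φ) ψ)) ∧
    Module.finrank ℂ (eqvHoms ((reductionMod n).comp φ).ker
      (quotChar ((reductionMod n).comp φ) ψ)) = depth φ hφ (charPoint n ψ) := by
  have hχ : quotChar ((reductionMod n).comp φ) ψ = (torusChar (charPoint n ψ)).comp φ := by
    rw [torusChar_charPoint]
    rfl
  have hsurj : Function.Surjective ((reductionMod n).comp φ) :=
    (reductionMod_surjective n).comp hφ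
  obtain ⟨b, hb⟩ : ∃ b, ψ b ≠ 1 := AddChar.ne_zero_iff.1 hψ
  obtain ⟨g, hg⟩ := hsurj (Multiplicative.ofAdd b)
  have hK : φ.ker ≤ ((reductionMod n).comp φ).ker := fun x hx => by
    rw [MonoidHom.mem_ker] at hx ⊢
    rw [MonoidHom.comp_apply, hx, map_one]
  have hg' : quotChar ((reductionMod n).comp φ) ψ g ≠ 1 := by
    rw [quotChar_apply, hg]
    exact hb
  have e := eqvEquiv (χ := quotChar ((reductionMod n).comp φ) ψ)
    hK (fun a b => by simp [MonoidHom.mem_ker, mul_comm (φ a)]) hg' (fun x hx => by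
      rw [quotChar_apply, MonoidHom.mem_ker.1 hx]
      simp)
  rw [hχ] at e ⊢
  have := finite_eqvHoms φ (charPoint n ψ) hφ
  exact ⟨Module.Finite.equiv e.symm, by rw [e.finrank_eq, finrank_eqvHoms]⟩

/-- The trivial character contributes `Hom(G, ℂ)`, each other one the depth at its point of the
torus. -/
theorem finrank_addHoms_ker_reduction (hn : ∀ i, 0 < n i) :
    Module.Finite ℂ (addHoms ((reductionMod n).comp φ).ker) ∧
    Module.finrank ℂ (addHoms ((reductionMod n).comp φ).ker) = Module.finrank ℂ (addHoms G) +
      ∑ᶠ ω ∈ {ω : Fin r → ℂˣ | (∀ i, ω i ^ n i = 1) ∧ ω ≠ 1}, depth φ hφ ω := by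
  classical
  have (i : Fin r) : NeZero (n i) := ⟨(hn i).ne'⟩
  set π := (reductionMod n).comp φ with hπdef
  have hsurj : Function.Surjective π := (reductionMod_surjective n).comp hφ
  have e0 : addHoms G ≃ₗ[ℂ] eqvHoms π.ker (quotChar π 0) :=
    addHomsEquiv (fun a b => by simp [MonoidHom.mem_ker, mul_comm (π a)])
      -- The order of the finite quotient serves as exponent: it sends every element of `G` into the
      -- kernel.
      (d := Fintype.card (Multiplicative (∀ i, ZMod (n i)))) Fintype.card_ne_zero
      (fun g => by rw [MonoidHom.mem_ker, map_pow, pow_card_eq_one])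
  have hfin0 := finite_addHoms φ hφ
  have hfin (ψ : AddChar (∀ i, ZMod (n i)) ℂ) : Module.Finite ℂ (eqvHoms π.ker (quotChar π ψ)) := by
    by_cases hψ : ψ = 0
    · subst hψ
      exact Module.Finite.equiv e0
    · exact (finite_finrank_eqvHoms_reduction φ hφ n ψ hψ).1
  refine ⟨Module.Finite.equiv (eqvDecomposition π hsurj), ?_⟩
  rw [← (eqvDecomposition π hsurj).finrank_eq, Module.finrank_pi_fintype,
    ← Finset.add_sum_erase _ _ (Finset.mem_univ (0 : AddChar (∀ i, ZMod (n i)) ℂ)),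
    ← e0.finrank_eq, ← charPoint_image, finsum_mem_image ((charPoint_injective n).injOn)]
  congr 1
  have hset : {ψ : AddChar (∀ i, ZMod (n i)) ℂ | ψ ≠ 0} =
      ((Finset.univ.erase 0 : Finset (AddChar (∀ i, ZMod (n i)) ℂ)) : Set _) := by
    ext; simp
  rw [hset, finsum_mem_coe_finset]
  exact Finset.sum_congr rfl fun ψ hψ =>
    (finite_finrank_eqvHoms_reduction φ hφ n ψ (Finset.ne_of_mem_erase hψ)).2

/-- Isomorphic groups have isomorphic spaces of homomorphisms to `ℂ`. -/
def addHomsCongr {H : Type*} [Group H] (e : G ≃* H) : addHoms H ≃ₗ[ℂ] addHoms G where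
  toFun f := ⟨fun x => f.1 (e x), fun a b => by beta_reduce; rw [map_mul, f.2]⟩
  invFun f := ⟨fun x => f.1 (e.symm x), fun a b => by beta_reduce; rw [map_mul, f.2]⟩
  map_add' _ _ := rfl
  map_smul' _ _ := rfl
  left_inv f := by ext; simp
  right_inv f := by ext; simp

end Covers

/-! ### Passage from fundamental groups back to homology. -/

section Topology

theorem IsCoveringMap.mapOfEq_injective {X E : Type*} [TopologicalSpace X] [TopologicalSpace E]
    {p : C(E, X)} (hp : IsCoveringMap p) {e : E} {x : X} (hx : p e = x) :
    Function.Injective (FundamentalGroup.mapOfEq p hx) := by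
  subst hx
  intro a b hab
  rw [FundamentalGroup.mapOfEq_apply, FundamentalGroup.mapOfEq_apply,
    Path.Homotopic.Quotient.cast_rfl_rfl, Path.Homotopic.Quotient.cast_rfl_rfl] at hab
  exact hp.injective_path_homotopic_map e e hab

theorem finite_H1_of_addHoms {Y : Type*} [TopologicalSpace Y] [PathConnectedSpace Y] (y : Y)
    [Module.Finite ℂ (addHoms (FundamentalGroup Y y))] :
    Module.Finite ℂ (H1 Y) ∧
      Module.finrank ℂ (H1 Y) = Module.finrank ℂ (addHoms (FundamentalGroup Y y)) := by
  obtain ⟨e⟩ := nonempty_dual_H1_equiv_addHoms y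
  have h1 : Module.Finite ℂ (Module.Dual ℂ (H1 Y)) := Module.Finite.equiv e.symm
  have h2 : Module.Finite ℂ (H1 Y) := Module.finite_dual_iff ℂ |>.1 h1
  exact ⟨h2, by rw [← e.finrank_eq, Subspace.dual_finrank_eq]⟩

end Topology

end

theorem mainTheorem4 {X : Type*} [TopologicalSpace X] [T2Space X]
    [Topology.CWComplex (Set.univ : Set X)] [PathConnectedSpace X] (x : X)
    {r : ℕ} (φ : FundamentalGroup X x →* FreeAb r) (hφ : Function.Surjective φ)
    (hfin : Module.Finite (LaurentRing r) (AlexanderModule φ hφ))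
    (n : Fin r → ℕ) (hn : ∀ i, 0 < n i)
    {E : Type*} [TopologicalSpace E] (p : C(E, X)) (e : E) (hx : p e = x)
    (hE : IsCoveringOf p e hx ((reductionMod n).comp φ).ker) :
    Module.Finite ℂ (H1 X) ∧ Module.Finite ℂ (H1 E) ∧
    Module.finrank ℂ (H1 E) = Module.finrank ℂ (H1 X) +
      ∑ᶠ ω ∈ {ω : Fin r → ℂˣ | (∀ i, ω i ^ n i = 1) ∧ ω ≠ 1}, depth φ hφ ω ∧
    (Module.finrank ℂ (H1 X) = r →
      Module.finrank ℂ (H1 E) = r +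
        ∑ᶠ ω ∈ {ω : Fin r → ℂˣ | (∀ i, ω i ^ n i = 1) ∧ ω ≠ 1}, depth φ hφ ω) := by
  have := hE.pathConnected
  have := finite_addHoms φ hφ
  obtain ⟨hNfin, hN⟩ := finrank_addHoms_ker_reduction φ hφ n hn
  -- Injectivity identifies the fundamental group of the cover with its image, which is the
  -- prescribed kernel.
  let eN : FundamentalGroup E e ≃* ((reductionMod n).comp φ).ker :=
    (MonoidHom.ofInjective (hE.isCoveringMap.mapOfEq_injective hx)).trans
      (MulEquiv.subgroupCongr hE.range_eq)
  have : Module.Finite ℂ (addHoms (FundamentalGroup E e)) := Module.Finite.equiv (addHomsCongr eN)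
  obtain ⟨hX, hX'⟩ := finite_H1_of_addHoms x
  obtain ⟨hE1, hE1'⟩ := finite_H1_of_addHoms e
  rw [← (addHomsCongr eN).finrank_eq, hN, ← hX'] at hE1'
  exact ⟨hX, hE1, hE1', fun h => hE1'.trans (by rw [h])⟩
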